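/- Let $\times$ be the $7$-dimensional cross product on $\mathbb{R}^7$: the alternating bilinear product which, on the canonical basis $\mathbf e_1,\dots,\mathbf e_7$, is given by $\mathbf e_1\times\mathbf e_2=\mathbf e_3$, $\mathbf e_1\times\mathbf e_4=\mathbf e_5$, $\mathbf e_1\times\mathbf e_7=\mathbf e_6$, $\mathbf e_2\times\mathbf e_4=\mathbf e_6$, $\mathbf e_2\times\mathbf e_5=\mathbf e_7$, $\mathbf e_3\times\mathbf e_4=\mathbf e_7$, $\mathbf e_3\times\mathbf e_6=\mathbf e_5$ and the cyclic permutations of these relations. Let $S^6\subset\mathbb{R}^7$ be the unit sphere with its nearly Kähler structure $J\mathbf u=\mathbf x\times\mathbf u$, $\mathbf u\in T_{\mathbf x}S^6$. For a unit vector $\mathbf v$ and an angle $\beta$, let $R_{\mathbf v}(\beta)\in SO(7)$ be the rotation that fixes $\mathbf v$ and satisfies $R_{\mathbf v}(\beta)\mathbf x=\cos\beta\,\mathbf x+\sin\beta\,\mathbf v\times\mathbf x$ for $\mathbf x\perp\mathbf v$. An almost complex curve is a non-constant smooth map from a Riemann surface to $S^6$ whose differential is complex linear with respect to $J$; it is of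 type (III) if it is linearly full in some totally geodesic $S^5\subset S^6$, that is, if its image spans a $6$-dimensional subspace of $\mathbb{R}^7$. **Theorem.** Let $\Sigma$ be a connected Riemann surface and let $\varphi:\Sigma\to S^6$ be a (conformal) minimal immersion that is totally real, i.e. $J\,d\varphi(X)\perp d\varphi(Y)$ for all tangent vectors $X,Y$ of $\Sigma$ at the same point. Let $F:\Sigma\to\mathbb{R}^7$ be a smooth map with $dF=\varphi\times *d\varphi$, that is, $F_x=\varphi\times\varphi_y$ and $F_y=-\varphi\times\varphi_x$ in every local conformal coordinate $x+iy$ (such an $F$ exists if $\Sigma$ is simply connected). Then $F^+=F+\varphi$ and $F^-=F-\varphi$ are conformal immersions into $\mathbb{R}^7$, and both of them have parallel mean curvature vector field (in their normal bundles) if, and only if, one of the following holds: 1. there exist a unit vector $\mathbf v$, an angle $\beta$ and a map $\tilde\varphi:\Sigma\to S^6$ with $\tilde\varphi(\Sigma)\subset S^6\cap\mathbf v^\perp$ that is, for the given orientation of $\Sigma$ or for the opposite one, an almost complex curve of type (III), such that $\varphi=R_{\mathbf v}(\beta)\tilde\varphi$; 2. $\varphi$ is totally geodesic in $S^6$. 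-/

import Mathlib

open scoped Manifold ContDiff RealInnerProductSpace

noncomputable section

/-- Euclidean space `ℝ⁷`. -/
abbrev E7 : Type := EuclideanSpace ℝ (Fin 7)

/-- The seven dimensional cross product. With the canonical basis written `e₁, …, e₇` (the
coordinate of index `i : Fin 7` belongs to `eᵢ₊₁`), it is the bilinear alternating product with
`e₁ × e₂ = e₃`, `e₁ × e₄ = e₅`, `e₁ × e₇ = e₆`, `e₂ × e₄ = e₆`, `e₂ × e₅ = e₇`, `e₃ × e₄ = e₇`,
`e₃ × e₆ = e₅`, and their cyclic permutations. -/
def cross7 (x y : E7) : E7 :=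
  !₂[(x 1 * y 2 - x 2 * y 1) + (x 3 * y 4 - x 4 * y 3) - (x 5 * y 6 - x 6 * y 5),
     (x 2 * y 0 - x 0 * y 2) + (x 3 * y 5 - x 5 * y 3) + (x 4 * y 6 - x 6 * y 4),
     (x 0 * y 1 - x 1 * y 0) + (x 3 * y 6 - x 6 * y 3) - (x 4 * y 5 - x 5 * y 4),
     (x 4 * y 0 - x 0 * y 4) + (x 5 * y 1 - x 1 * y 5) + (x 6 * y 2 - x 2 * y 6),
     (x 0 * y 3 - x 3 * y 0) + (x 6 * y 1 - x 1 * y 6) + (x 2 * y 5 - x 5 * y 2),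
     (x 0 * y 6 - x 6 * y 0) + (x 1 * y 3 - x 3 * y 1) + (x 4 * y 2 - x 2 * y 4),
     (x 5 * y 0 - x 0 * y 5) + (x 1 * y 4 - x 4 * y 1) + (x 2 * y 3 - x 3 * y 2)]

/-- For a unit vector `v`, the rotation fixing `v` and equal to
`x ↦ cos β x + sin β (v × x)` on the orthogonal complement of `v`. -/
def rotation7 (v : E7) (β : ℝ) (x : E7) : E7 :=
  ⟪v, x⟫ • v + (Real.cos β • (x - ⟪v, x⟫ • v) + Real.sin β • cross7 v x)

/-! ### Parametrized surfaces

Here `f : ℂ → ℝ⁷` is a map that is a smooth immersion near the point `z`, `X Y : ℂ` are tangent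
vectors of the parameter plane, and `1` and `Complex.I` are the coordinate vectors
`∂/∂x`, `∂/∂y`. -/

/-- The component of `w` orthogonal to the tangent plane of `f` at `z`. -/
def normalPart (f : ℂ → E7) (z : ℂ) (w : E7) : E7 :=
  (LinearMap.range (fderiv ℝ f z).toLinearMap)ᗮ.starProjection w

/-- First fundamental form. -/
def firstFF (f : ℂ → E7) (z X Y : ℂ) : ℝ :=
  ⟪fderiv ℝ f z X, fderiv ℝ f z Y⟫

/-- Second fundamental form in `ℝ⁷`. -/
def secondFF (f : ℂ → E7) (z X Y : ℂ) : E7 :=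
  normalPart f z (fderiv ℝ (fderiv ℝ f) z X Y)

/-- Mean curvature vector in `ℝ⁷`: half of the trace of the second fundamental form with respect to
the first one. -/
def meanCurvature (f : ℂ → E7) (z : ℂ) : E7 :=
  (2 * (firstFF f z 1 1 * firstFF f z Complex.I Complex.I - firstFF f z 1 Complex.I ^ 2))⁻¹ •
    (firstFF f z Complex.I Complex.I • secondFF f z 1 1
      - (2 * firstFF f z 1 Complex.I) • secondFF f z 1 Complex.I
      + firstFF f z 1 1 • secondFF f z Complex.I Complex.I)

/-! ### Maps on a Riemann surface

A map `φ` on a Riemann surface `S` is differentiated in the charts `e` of the complex atlas of `S`,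
that is, through its coordinate expressions `φ ∘ e.symm` on `e.target ⊆ ℂ`. All the conditions below
are invariant under (holomorphic) changes of coordinates. -/

section Surfaces

variable {S : Type*} [TopologicalSpace S] [ChartedSpace ℂ S]

/-- `f` is a smooth immersion into `ℝ⁷` that is conformal for the complex structure of `S`. -/
def IsConformalImmersion (f : S → E7) : Prop :=
  ContMDiff 𝓘(ℝ, ℂ) 𝓘(ℝ, E7) ∞ f ∧
    ∀ e ∈ atlas ℂ S, ∀ z ∈ e.target,
      Function.Injective (fderiv ℝ (f ∘ e.symm) z) ∧
      firstFF (f ∘ e.symm) z 1 1 = firstFF (f ∘ e.symm) z Complex.I Complex.I ∧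
      firstFF (f ∘ e.symm) z 1 Complex.I = 0

/-- The mean curvature vector field of the immersion `f` in `ℝ⁷` is parallel in the normal bundle:
the normal component of its derivative in every tangent direction vanishes. -/
def HasParallelMeanCurvature (f : S → E7) : Prop :=
  ∀ e ∈ atlas ℂ S, ∀ z ∈ e.target, ∀ X : ℂ,
    normalPart (f ∘ e.symm) z (fderiv ℝ (meanCurvature (f ∘ e.symm)) z X) = 0

/-- `φ` is a minimal (conformal) immersion into the unit sphere `S⁶`: its mean curvature vector in
`S⁶`, which is the component tangent to `S⁶` of the mean curvature vector in `ℝ⁷`, vanishes. -/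
def IsMinimalImmersionInSphere (φ : S → E7) : Prop :=
  (∀ p, ‖φ p‖ = 1) ∧ IsConformalImmersion φ ∧
    ∀ e ∈ atlas ℂ S, ∀ z ∈ e.target,
      meanCurvature (φ ∘ e.symm) z
        - ⟪meanCurvature (φ ∘ e.symm) z, φ (e.symm z)⟫ • φ (e.symm z) = 0

/-- The immersion `φ` into `S⁶` is totally geodesic: its second fundamental form in `S⁶`, which is
the component tangent to `S⁶` of the second fundamental form in `ℝ⁷`, vanishes. -/
def IsTotallyGeodesicInSphere (φ : S → E7) : Prop :=
  ∀ e ∈ atlas ℂ S, ∀ z ∈ e.target, ∀ X Y : ℂ,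
    secondFF (φ ∘ e.symm) z X Y
      - ⟪secondFF (φ ∘ e.symm) z X Y, φ (e.symm z)⟫ • φ (e.symm z) = 0

/-- `φ : S → S⁶` is totally real: the nearly Kähler structure `J u = x × u`, `u ∈ TₓS⁶`, maps every
tangent space of `φ` into its orthogonal complement. -/
def IsTotallyReal (φ : S → E7) : Prop :=
  ∀ e ∈ atlas ℂ S, ∀ z ∈ e.target, ∀ X Y : ℂ,
    ⟪cross7 (φ (e.symm z)) (fderiv ℝ (φ ∘ e.symm) z X), fderiv ℝ (φ ∘ e.symm) z Y⟫ = 0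

/-- `F` integrates the one form `φ × *dφ`, where `*dφ = dφ ∘ i`; in a conformal coordinate
`x + i y`, `F_x = φ × φ_y` and `F_y = - φ × φ_x`. -/
def IsAssociatedSurface (φ F : S → E7) : Prop :=
  ContMDiff 𝓘(ℝ, ℂ) 𝓘(ℝ, E7) ∞ F ∧
    ∀ e ∈ atlas ℂ S, ∀ z ∈ e.target, ∀ X : ℂ,
      fderiv ℝ (F ∘ e.symm) z X =
        cross7 (φ (e.symm z)) (fderiv ℝ (φ ∘ e.symm) z (Complex.I * X))

/-- `φ` is an almost complex curve in the nearly Kähler `S⁶`: a non-constant smooth map into `S⁶`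
with `dφ (i X) = J dφ(X)`. Here `S` carries its own orientation if `ε = 1`, and the opposite one
(the complex structure `- i`) if `ε = -1`. -/
def IsAlmostComplexCurve (ε : ℤˣ) (φ : S → E7) : Prop :=
  (∀ p, ‖φ p‖ = 1) ∧ (∃ p q, φ p ≠ φ q) ∧ ContMDiff 𝓘(ℝ, ℂ) 𝓘(ℝ, E7) ∞ φ ∧
    ∀ e ∈ atlas ℂ S, ∀ z ∈ e.target, ∀ X : ℂ,
      fderiv ℝ (φ ∘ e.symm) z (ε • (Complex.I * X)) =
        cross7 (φ (e.symm z)) (fderiv ℝ (φ ∘ e.symm) z X)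

/-- An almost complex curve of type (III): one that is linearly full in some totally geodesic
`S⁵ ⊆ S⁶`, that is, whose image spans a hyperplane of `ℝ⁷`. -/
def IsAlmostComplexCurveTypeIII (ε : ℤˣ) (φ : S → E7) : Prop :=
  IsAlmostComplexCurve ε φ ∧ Module.finrank ℝ (Submodule.span ℝ (Set.range φ)) = 6

end Surfaces

end

noncomputable section

/-! In a conformal coordinate write a = φ_x, b = φ_y, E = |a|², Ju = φ × u, N = (a × b)/E. Total
reality makes φ, a, b, Ja, Jb, N, JN an orthogonal frame of ℝ⁷, so dF = J*dφ is orthogonal to dφ and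
has the same conformal factor: F^± are conformal with factor 2E. Since ΔF = 2 a × b and Δφ = -2Eφ,
their mean curvature vectors are ½(N ∓ φ) (`associated_meanCurvature`). Both are parallel exactly
when dN = -J*dφ (`associated_parallel_iff`).

Under this equation the unit vector v = φ × N has zero derivative (`fderiv_crossAxis`). It does not
depend on the coordinate, so it is constant on the connected surface. Then ψ = -v × φ is an almost
complex curve in v^⊥ and φ is ψ turned by a right angle about v (`isAlmostComplexCurve_of_axis`). If
ψ does not span v^⊥, some nonzero constant vector is orthogonal to v and to φ. The second
fundamental form of φ is a trace-free symmetric cubic form with values in J dφ; wherever it is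
nonzero, that constant vector is forced to be orthogonal to the whole frame. Hence φ is totally
geodesic (`axis_geodesic_of_degenerate`).

Conversely, for φ = R_v(β)ψ total reality forces cos 3β = 0, so that N = ± v × φ and the equation
for dN follows (`crossNormalIsDual_of_rotation`). For a totally geodesic φ it comes from
differentiating E N = a × b (`fderiv_crossNormal_of_geodesic`). -/

/-! ### Algebra of the cross product. -/

theorem inner_eq_coord_sum (x y : E7) : ⟪x, y⟫ = x 0 * y 0 + x 1 * y 1 + x 2 * y 2 + x 3 * y 3 +
    x 4 * y 4 + x 5 * y 5 + x 6 * y 6 := by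
  simp only [PiLp.inner_apply, Fin.sum_univ_seven, RCLike.inner_apply, conj_trivial]
  ring

theorem cross7_add_left (x y z : E7) : cross7 (x + y) z = cross7 x z + cross7 y z := by
  ext i
  fin_cases i <;> simp [cross7] <;> ring

theorem cross7_add_right (x y z : E7) : cross7 x (y + z) = cross7 x y + cross7 x z := by
  ext i
  fin_cases i <;> simp [cross7] <;> ring

theorem cross7_smul_left (c : ℝ) (x y : E7) : cross7 (c • x) y = c • cross7 x y := by
  ext i
  fin_cases i <;> simp [cross7] <;> ring

theorem cross7_smul_right (c : ℝ) (x y : E7) : cross7 x (c • y) = c • cross7 x y := by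
  ext i
  fin_cases i <;> simp [cross7] <;> ring

theorem cross7_anticomm (x y : E7) : cross7 x y = -cross7 y x := by
  ext i
  fin_cases i <;> simp [cross7] <;> ring

/-- The cross product as a continuous bilinear map. -/
def crossL : E7 →L[ℝ] E7 →L[ℝ] E7 :=
  LinearMap.toContinuousLinearMap
    (LinearMap.toContinuousLinearMap.toLinearMap ∘ₗ
      LinearMap.mk₂ ℝ cross7 cross7_add_left cross7_smul_left cross7_add_right cross7_smul_right)

@[simp] theorem crossL_apply (x y : E7) : crossL x y = cross7 x y := rfl

theorem cross7_self (x : E7) : cross7 x x = 0 := by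
  have h := cross7_anticomm x x
  rw [eq_neg_iff_add_eq_zero, ← two_smul ℝ] at h
  exact (smul_eq_zero.mp h).resolve_left two_ne_zero

theorem cross7_neg_left (x y : E7) : cross7 (-x) y = -cross7 x y := by
  simpa using cross7_smul_left (-1) x y

theorem cross7_neg_right (x y : E7) : cross7 x (-y) = -cross7 x y := by
  simpa using cross7_smul_right (-1) x y

@[simp] theorem cross7_zero_left (x : E7) : cross7 0 x = 0 := by
  simpa using cross7_smul_left 0 0 x

@[simp] theorem cross7_zero_right (x : E7) : cross7 x 0 = 0 := by
  simpa using cross7_smul_right 0 x 0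

theorem inner_cross7_cyclic (x y z : E7) : ⟪cross7 x y, z⟫ = ⟪cross7 y z, x⟫ := by
  simp [inner_eq_coord_sum, cross7]
  ring

theorem inner_cross7_right (x y : E7) : ⟪cross7 x y, y⟫ = 0 := by
  rw [inner_cross7_cyclic, cross7_self, inner_zero_left]

theorem inner_cross7_left (x y : E7) : ⟪cross7 x y, x⟫ = 0 := by
  rw [cross7_anticomm, inner_neg_left, inner_cross7_right, neg_zero]

/-- The cross product with a fixed vector is skew-symmetric. -/
theorem inner_cross7_skew (x y z : E7) : ⟪cross7 x y, z⟫ = -⟪y, cross7 x z⟫ := by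
  rw [inner_cross7_cyclic, inner_cross7_cyclic, cross7_anticomm, inner_neg_left, real_inner_comm]

/-- Checked in coordinates. With bilinearity, skew-symmetry and the cyclic triple product, this is
all that later arguments use of the multiplication table. -/
theorem cross7_cross7_self (x y : E7) : cross7 x (cross7 x y) = ⟪x, y⟫ • x - ⟪x, x⟫ • y := by
  rw [inner_eq_coord_sum, inner_eq_coord_sum]
  ext i
  fin_cases i <;> simp [cross7] <;> ring

/-- Polarization in the repeated factor. For mutually orthogonal vectors the right side vanishes,
which replaces associativity. -/
theorem cross7_cross7_symm (x y z : E7) : cross7 x (cross7 y z) + cross7 y (cross7 x z) =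
    ⟪x, z⟫ • y + ⟪y, z⟫ • x - (2 * ⟪x, y⟫) • z := by
  have h := cross7_cross7_self (x + y) z
  simp only [cross7_add_left, cross7_add_right, cross7_cross7_self, inner_add_left,
    inner_add_right, real_inner_comm x y] at h
  rw [← sub_eq_zero] at h ⊢
  rw [← h]
  module

theorem inner_cross7_cross7 (x y z : E7) :
    ⟪cross7 x y, cross7 x z⟫ = ⟪x, x⟫ * ⟪y, z⟫ - ⟪x, y⟫ * ⟪x, z⟫ := by
  rw [inner_cross7_skew, cross7_cross7_self, inner_sub_right, real_inner_smul_right,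
    real_inner_smul_right, real_inner_comm y x]
  ring

/-! ### The orthogonal frame of a totally real plane. -/

/-- `a, b` is a conformal basis, with squared length `E`, of a totally real plane tangent to `S⁶`
at `p`. -/
structure IsTotallyRealFrame (p a b : E7) (E : ℝ) : Prop where
  pos : 0 < E
  pp : ⟪p, p⟫ = 1
  pa : ⟪p, a⟫ = 0
  pb : ⟪p, b⟫ = 0
  aa : ⟪a, a⟫ = E
  bb : ⟪b, b⟫ = E
  ab : ⟪a, b⟫ = 0
  real : ⟪cross7 p a, b⟫ = 0

namespace IsTotallyRealFrame

variable {p a b : E7} {E : ℝ} (h : IsTotallyRealFrame p a b E)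
include h

theorem swap : IsTotallyRealFrame p b a E where
  pos := h.pos
  pp := h.pp
  pa := h.pb
  pb := h.pa
  aa := h.bb
  bb := h.aa
  ab := by rw [real_inner_comm, h.ab]
  real := by rw [inner_cross7_skew, real_inner_comm, h.real, neg_zero]

theorem inner_normal_point : ⟪cross7 a b, p⟫ = 0 := by
  rw [inner_cross7_cyclic, inner_cross7_cyclic, h.real]

theorem inner_Ja_Ja : ⟪cross7 p a, cross7 p a⟫ = E := by
  rw [inner_cross7_cross7, h.pp, h.pa, h.aa]; ring

theorem inner_Jb_Jb : ⟪cross7 p b, cross7 p b⟫ = E := h.swap.inner_Ja_Ja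

theorem inner_Ja_Jb : ⟪cross7 p a, cross7 p b⟫ = 0 := by
  rw [inner_cross7_cross7, h.pa, h.pb, h.ab]; ring

theorem inner_Jb_a : ⟪cross7 p b, a⟫ = 0 := h.swap.real

theorem inner_normal_Ja : ⟪cross7 a b, cross7 p a⟫ = 0 := by
  rw [cross7_anticomm p a, inner_neg_right, inner_cross7_cross7, real_inner_comm p b, h.pb, h.ab]
  simp

theorem inner_normal_Jb : ⟪cross7 a b, cross7 p b⟫ = 0 := by
  rw [cross7_anticomm a b, inner_neg_left, h.swap.inner_normal_Ja, neg_zero]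

theorem inner_normal_normal : ⟪cross7 a b, cross7 a b⟫ = E * E := by
  rw [inner_cross7_cross7, h.aa, h.bb, h.ab]; ring

theorem cross_a_normal : cross7 a (cross7 a b) = -(E • b) := by
  rw [cross7_cross7_self, h.ab, h.aa]; simp

theorem cross_b_normal : cross7 b (cross7 a b) = E • a := by
  rw [cross7_anticomm a b, cross7_neg_right, h.swap.cross_a_normal, neg_neg]

/-- The vectors a, p and a × b are mutually orthogonal, so a × (p × (a × b)) = -p × (a × (a × b)),
and the inner double product is -E b. -/
theorem cross_Jnormal_a : cross7 (cross7 p (cross7 a b)) a = -(E • cross7 p b) := by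
  have h1 := cross7_cross7_symm a p (cross7 a b)
  rw [real_inner_comm, inner_cross7_left, real_inner_comm, h.inner_normal_point,
    real_inner_comm, h.pa, h.cross_a_normal, cross7_neg_right, cross7_smul_right] at h1
  rw [cross7_anticomm, neg_inj, ← sub_eq_zero, sub_eq_add_neg, h1]
  simp

theorem cross_Jnormal_b : cross7 (cross7 p (cross7 a b)) b = E • cross7 p a := by
  rw [cross7_anticomm a b, cross7_neg_right, cross7_neg_left, h.swap.cross_Jnormal_a, neg_neg]

theorem inner_Jnormal_a : ⟪cross7 p (cross7 a b), a⟫ = 0 := by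
  rw [inner_cross7_skew, h.inner_normal_Ja, neg_zero]

theorem inner_Jnormal_b : ⟪cross7 p (cross7 a b), b⟫ = 0 := by
  rw [inner_cross7_skew, h.inner_normal_Jb, neg_zero]

theorem inner_Jnormal_Ja : ⟪cross7 p (cross7 a b), cross7 p a⟫ = 0 := by
  rw [inner_cross7_cross7, inner_cross7_left, h.pa]; ring

theorem inner_Jnormal_Jb : ⟪cross7 p (cross7 a b), cross7 p b⟫ = 0 := by
  rw [inner_cross7_cross7, inner_cross7_right, h.pb]; ring

theorem inner_Jnormal_Jnormal :
    ⟪cross7 p (cross7 a b), cross7 p (cross7 a b)⟫ = E * E := by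
  rw [inner_cross7_cross7, h.pp, h.inner_normal_normal, real_inner_comm, h.inner_normal_point]
  ring

/-- The point, the tangent plane, its image under `J`, the normal `a × b` and its image under `J`
span the ambient space. -/
theorem eq_zero {u : E7} (hp : ⟪u, p⟫ = 0) (ha : ⟪u, a⟫ = 0) (hb : ⟪u, b⟫ = 0)
    (hJa : ⟪u, cross7 p a⟫ = 0) (hJb : ⟪u, cross7 p b⟫ = 0) (hn : ⟪u, cross7 a b⟫ = 0)
    (hJn : ⟪u, cross7 p (cross7 a b)⟫ = 0) : u = 0 := by
  let f : Fin 7 → E7 := ![p, a, b, cross7 p a, cross7 p b, cross7 a b, cross7 p (cross7 a b)]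
  have hE : E ≠ 0 := h.pos.ne'
  have hlt : ∀ i j, i < j → ⟪f j, f i⟫ = 0 := by
    have e1 := h.pa; have e2 := h.pb; have e3 := h.ab
    rw [real_inner_comm] at e1 e2 e3
    intro i j hij
    fin_cases i <;> fin_cases j <;> first
      | exact absurd hij (by decide)
      | simp [f, e1, e2, e3, h.real, h.inner_normal_point, h.inner_Ja_Jb, h.inner_Jb_a,
          h.inner_normal_Ja, h.inner_normal_Jb, h.inner_Jnormal_a, h.inner_Jnormal_b,
          h.inner_Jnormal_Ja, h.inner_Jnormal_Jb, inner_cross7_left, inner_cross7_right,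
          real_inner_comm (cross7 p a) (cross7 p b)]
  have h0 : ∀ i, f i ≠ 0 := by
    intro i hi
    have h1 : ⟪f i, f i⟫ = 0 := by rw [hi, inner_zero_left]
    revert h1
    fin_cases i
    · exact fun h1 => one_ne_zero (h.pp.symm.trans h1)
    · exact fun h1 => hE (h.aa.symm.trans h1)
    · exact fun h1 => hE (h.bb.symm.trans h1)
    · exact fun h1 => hE (h.inner_Ja_Ja.symm.trans h1)
    · exact fun h1 => hE (h.inner_Jb_Jb.symm.trans h1)
    · exact fun h1 => mul_ne_zero hE hE (h.inner_normal_normal.symm.trans h1)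
    · exact fun h1 => mul_ne_zero hE hE (h.inner_Jnormal_Jnormal.symm.trans h1)
  have hli : LinearIndependent ℝ f := by
    refine linearIndependent_of_ne_zero_of_inner_eq_zero h0 fun i j hij => ?_
    rcases lt_or_gt_of_ne hij with h1 | h1
    · exact (real_inner_comm _ _).trans (hlt i j h1)
    · exact hlt j i h1
  have hspan := hli.span_eq_top_of_card_eq_finrank (by simp)
  have hperp : ∀ y ∈ Submodule.span ℝ (Set.range f), ⟪u, y⟫ = 0 := by
    intro y hy
    induction hy using Submodule.span_induction with
    | mem y hy =>
      obtain ⟨i, rfl⟩ := hy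
      fin_cases i <;> assumption
    | zero => exact inner_zero_right _
    | add y z _ _ hy hz => rw [inner_add_right, hy, hz, add_zero]
    | smul c y _ hy => rw [real_inner_smul_right, hy, mul_zero]
  exact inner_self_eq_zero.mp (hperp u (hspan ▸ Submodule.mem_top))

/-- A vector orthogonal to the normals `a × b` and `J (a × b)`, expanded in the frame. -/
theorem expand {u : E7} (hn : ⟪u, cross7 a b⟫ = 0) (hJn : ⟪u, cross7 p (cross7 a b)⟫ = 0) :
    u = ⟪u, p⟫ • p + (⟪u, a⟫ / E) • a + (⟪u, b⟫ / E) • b + (⟪u, cross7 p a⟫ / E) • cross7 p a +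
      (⟪u, cross7 p b⟫ / E) • cross7 p b := by
  have hE : E ≠ 0 := h.pos.ne'
  have e1 := h.pa; have e2 := h.pb; have e3 := h.ab; have e4 := h.inner_Ja_Jb
  rw [real_inner_comm] at e1 e2 e3 e4
  have f1 := h.real; have f2 := h.inner_Jb_a; have f3 := inner_cross7_left p a
  have f4 := inner_cross7_left p b; have f5 := inner_cross7_right p a
  have f6 := inner_cross7_right p b
  rw [real_inner_comm] at f1 f2 f3 f4 f5 f6
  have g1 := h.inner_normal_point; have g2 := inner_cross7_left a b
  have g3 := inner_cross7_right a b; have g4 := h.inner_normal_Ja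
  have g5 := h.inner_normal_Jb; have g6 := inner_cross7_left p (cross7 a b)
  have g7 := h.inner_Jnormal_a; have g8 := h.inner_Jnormal_b
  have g9 := h.inner_Jnormal_Ja; have g10 := h.inner_Jnormal_Jb
  rw [real_inner_comm] at g1 g2 g3 g4 g5 g6 g7 g8 g9 g10
  refine sub_eq_zero.mp (h.eq_zero ?_ ?_ ?_ ?_ ?_ ?_ ?_) <;>
    simp [inner_sub_left, inner_add_left, real_inner_smul_left, e1, e2, e3, e4, f1, f2, f3, f4, f5,
      f6, g1, g2, g3, g4, g5, g6, g7, g8, g9, g10, h.pa, h.pb, h.ab, h.real, h.inner_Jb_a,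
      inner_cross7_left, inner_cross7_right, h.inner_Ja_Jb, hn, hJn, -inner_self_eq_norm_sq_to_K,
      h.pp, h.aa, h.bb, h.inner_Ja_Ja, h.inner_Jb_Jb, hE]

end IsTotallyRealFrame

/-- Rotating both factors of a cross product about a unit vector `v`. -/
theorem cross7_rotate {v x u : E7} (c s : ℝ) (hv : ⟪v, v⟫ = 1) (hx : ⟪v, x⟫ = 0)
    (hu : ⟪v, u⟫ = 0) (hxu : ⟪x, u⟫ = 0) (hvxu : ⟪cross7 x u, v⟫ = 0) :
    cross7 (c • x + s • cross7 v x) (c • u + s • cross7 v u) =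
      (c ^ 2 - s ^ 2) • cross7 x u - (2 * c * s) • cross7 v (cross7 x u) := by
  -- Orthogonality lets factors be exchanged up to sign, so every product reduces to x × u or v × (x
  -- × u). The coefficients that result are those of the doubled angle.
  have h1 : cross7 x (cross7 v u) = -cross7 v (cross7 x u) := by
    have := cross7_cross7_symm x v u
    rw [hxu, hu, real_inner_comm, hx] at this
    rw [← add_eq_zero_iff_eq_neg, this]
    simp
  have h2 : cross7 (cross7 v x) u = -cross7 v (cross7 x u) := by
    have := cross7_cross7_symm u v x
    rw [real_inner_comm, hxu, hx, real_inner_comm, hu] at this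
    rw [cross7_anticomm, cross7_anticomm x u, cross7_neg_right, neg_inj, ← add_eq_zero_iff_eq_neg,
      this]
    simp
  have h3 : cross7 (cross7 v x) (cross7 v u) = -cross7 x u := by
    have := cross7_cross7_symm (cross7 v x) v u
    rw [inner_cross7_cyclic, hvxu, hu, inner_cross7_left, h2, cross7_neg_right, cross7_cross7_self,
      real_inner_comm, hvxu, hv] at this
    have h4 := eq_sub_of_add_eq this
    rw [h4]
    module
  simp only [cross7_add_left, cross7_add_right, cross7_smul_left, cross7_smul_right, h1, h2, h3]
  module

theorem clm_complex_apply {G : Type*} [AddCommGroup G] [Module ℝ G] [TopologicalSpace G]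
    (L : ℂ →L[ℝ] G) (X : ℂ) : L X = X.re • L 1 + X.im • L Complex.I := by
  conv_lhs => rw [← Complex.re_add_im X, ← mul_one (X.re : ℂ)]
  simp only [← Complex.real_smul, map_add, map_smul]

theorem clm_complex_apply_I_mul {G : Type*} [AddCommGroup G] [Module ℝ G] [TopologicalSpace G]
    (L : ℂ →L[ℝ] G) (X : ℂ) : L (Complex.I * X) = -X.im • L 1 + X.re • L Complex.I := by
  rw [clm_complex_apply]
  simp

/-! ### Conformal immersions of plane domains -/

/-- `g` is a smooth conformal immersion on the open set `U`. -/
structure IsConformalImmersionOn (g : ℂ → E7) (U : Set ℂ) : Prop where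
  isOpen : IsOpen U
  smooth : ContDiffOn ℝ ∞ g U
  inj : ∀ z ∈ U, Function.Injective (fderiv ℝ g z)
  conf : ∀ z ∈ U, firstFF g z 1 1 = firstFF g z Complex.I Complex.I
  orth : ∀ z ∈ U, firstFF g z 1 Complex.I = 0

section Smooth

variable {g : ℂ → E7} {U : Set ℂ} {z : ℂ}

theorem ContDiffOn.hasFDerivAt_of_isOpen (hg : ContDiffOn ℝ ∞ g U) (hU : IsOpen U) (hz : z ∈ U) :
    HasFDerivAt g (fderiv ℝ g z) z :=
  ((hg.contDiffAt (hU.mem_nhds hz)).differentiableAt (by simp)).hasFDerivAt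

theorem ContDiffOn.hasFDerivAt_fderiv_apply (hg : ContDiffOn ℝ ∞ g U) (hU : IsOpen U)
    (hz : z ∈ U) (X : ℂ) :
    HasFDerivAt (fun w => fderiv ℝ g w X) ((fderiv ℝ (fderiv ℝ g) z).flip X) z := by
  have h1 : ContDiffAt ℝ ∞ (fderiv ℝ g) z :=
    (hg.contDiffAt (hU.mem_nhds hz)).fderiv_right (m := ∞) (by simp)
  have h2 := (h1.differentiableAt (by simp)).hasFDerivAt
  simpa using h2.clm_apply (hasFDerivAt_const X z)

theorem ContDiffOn.fderiv_fderiv_symm (hg : ContDiffOn ℝ ∞ g U) (hU : IsOpen U) (hz : z ∈ U)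
    (X Y : ℂ) : fderiv ℝ (fderiv ℝ g) z X Y = fderiv ℝ (fderiv ℝ g) z Y X :=
  ((hg.contDiffAt (hU.mem_nhds hz)).isSymmSndFDerivAt
    (by rw [minSmoothness_of_isRCLikeNormedField]; exact ENat.LEInfty.out)) X Y

end Smooth

theorem HasFDerivAt.cross7 {f g : ℂ → E7} {f' g' : ℂ →L[ℝ] E7} {z : ℂ} (hf : HasFDerivAt f f' z)
    (hg : HasFDerivAt g g' z) : HasFDerivAt (fun w => cross7 (f w) (g w))
      ((crossL (f z)).comp g' + (crossL.flip (g z)).comp f') z := by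
  refine (crossL.hasFDerivAt_of_bilinear hf hg).congr_fderiv ?_
  ext1 X
  simp [ContinuousLinearMap.precompR_apply, ContinuousLinearMap.precompL_apply]

/-- Differentiating the constancy of an inner product. -/
theorem inner_fderiv_eq_zero {f g : ℂ → E7} {f' g' : ℂ →L[ℝ] E7} {U : Set ℂ} {z : ℂ} {c : ℝ}
    (hU : IsOpen U) (hz : z ∈ U) (hf : HasFDerivAt f f' z) (hg : HasFDerivAt g g' z)
    (h : ∀ w ∈ U, ⟪f w, g w⟫ = c) (X : ℂ) : ⟪f z, g' X⟫ + ⟪f' X, g z⟫ = 0 := by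
  have h1 := hf.inner ℝ hg
  have h2 : HasFDerivAt (fun w => ⟪f w, g w⟫) (0 : ℂ →L[ℝ] ℝ) z :=
    (hasFDerivAt_const c z).congr_of_eventuallyEq
      (Filter.eventually_of_mem (hU.mem_nhds hz) fun w hw => h w hw)
  simpa using congrArg (fun L : ℂ →L[ℝ] ℝ => L X) (h1.unique h2)

namespace IsConformalImmersionOn

variable {g : ℂ → E7} {U : Set ℂ} {z : ℂ} (h : IsConformalImmersionOn g U) (hz : z ∈ U)
include h hz

theorem hasFDerivAt : HasFDerivAt g (fderiv ℝ g z) z := h.smooth.hasFDerivAt_of_isOpen h.isOpen hz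

theorem hasFDerivAt_fderiv (X : ℂ) :
    HasFDerivAt (fun w => fderiv ℝ g w X) ((fderiv ℝ (fderiv ℝ g) z).flip X) z :=
  h.smooth.hasFDerivAt_fderiv_apply h.isOpen hz X

theorem symm (X Y : ℂ) : fderiv ℝ (fderiv ℝ g) z X Y = fderiv ℝ (fderiv ℝ g) z Y X :=
  h.smooth.fderiv_fderiv_symm h.isOpen hz X Y

theorem pos : 0 < firstFF g z 1 1 := by
  refine real_inner_self_pos.mpr fun h0 => one_ne_zero (α := ℂ) (h.inj z hz ?_)
  rw [h0, map_zero]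

theorem conf_deriv (X : ℂ) : ⟪fderiv ℝ (fderiv ℝ g) z X 1, fderiv ℝ g z 1⟫ =
    ⟪fderiv ℝ (fderiv ℝ g) z X Complex.I, fderiv ℝ g z Complex.I⟫ := by
  -- Equality of the two lengths is written as ⟨g_x + g_y, g_x - g_y⟩ = 0, so that a single constant
  -- inner product is differentiated.
  have h1 := inner_fderiv_eq_zero h.isOpen hz
    ((h.hasFDerivAt_fderiv hz 1).add (h.hasFDerivAt_fderiv hz Complex.I))
    ((h.hasFDerivAt_fderiv hz 1).sub (h.hasFDerivAt_fderiv hz Complex.I)) (c := 0)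
    (fun w hw => by
      have h2 := h.conf w hw
      simp only [firstFF] at h2
      simp only [Pi.add_apply, Pi.sub_apply, inner_add_left, inner_sub_right,
        real_inner_comm (fderiv ℝ g w 1) (fderiv ℝ g w Complex.I)]
      linarith) X
  simp only [add_apply, sub_apply,
    ContinuousLinearMap.flip_apply, Pi.add_apply, Pi.sub_apply, inner_add_left, inner_sub_right]
    at h1
  simp only [real_inner_comm (fderiv ℝ (fderiv ℝ g) z X _)] at h1 ⊢
  linarith

theorem orth_deriv (X : ℂ) : ⟪fderiv ℝ (fderiv ℝ g) z X 1, fderiv ℝ g z Complex.I⟫ +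
    ⟪fderiv ℝ (fderiv ℝ g) z X Complex.I, fderiv ℝ g z 1⟫ = 0 := by
  have h1 := inner_fderiv_eq_zero h.isOpen hz (h.hasFDerivAt_fderiv hz 1)
    (h.hasFDerivAt_fderiv hz Complex.I) h.orth X
  simp only [ContinuousLinearMap.flip_apply] at h1
  rw [real_inner_comm (fderiv ℝ g z 1)]
  linarith

omit h hz in
theorem mem_orthogonal_range {w : E7} :
    w ∈ (LinearMap.range (fderiv ℝ g z).toLinearMap)ᗮ ↔
      ⟪w, fderiv ℝ g z 1⟫ = 0 ∧ ⟪w, fderiv ℝ g z Complex.I⟫ = 0 := by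
  rw [Submodule.mem_orthogonal']
  constructor
  · exact fun hw => ⟨hw _ ⟨1, rfl⟩, hw _ ⟨Complex.I, rfl⟩⟩
  · rintro ⟨h1, h2⟩ _ ⟨X, rfl⟩
    rw [ContinuousLinearMap.coe_coe, clm_complex_apply, inner_add_right, real_inner_smul_right,
      real_inner_smul_right, h1, h2]
    simp

omit h hz in
theorem normalPart_eq_zero_iff {w : E7} :
    normalPart g z w = 0 ↔ ∃ X, fderiv ℝ g z X = w := by
  rw [normalPart, Submodule.starProjection_apply, Submodule.coe_eq_zero,
    Submodule.orthogonalProjectionOnto_eq_zero_iff, Submodule.orthogonal_orthogonal]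
  rfl

omit h hz in
theorem normalPart_add (w w' : E7) : normalPart g z (w + w') =
    normalPart g z w + normalPart g z w' :=
  map_add _ w w'

theorem normalPart_eq (w : E7) : normalPart g z w =
    w - (⟪w, fderiv ℝ g z 1⟫ / firstFF g z 1 1) • fderiv ℝ g z 1 -
      (⟪w, fderiv ℝ g z Complex.I⟫ / firstFF g z 1 1) • fderiv ℝ g z Complex.I := by
  have hE := (h.pos hz).ne'
  have h1 := h.conf z hz
  have h2 := h.orth z hz
  have h3 := h2
  simp only [firstFF] at hE h1 h2 h3
  rw [real_inner_comm] at h3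
  set a := fderiv ℝ g z 1 with ha
  set b := fderiv ℝ g z Complex.I with hb
  have key : w = (w - (⟪w, a⟫ / ⟪a, a⟫) • a - (⟪w, b⟫ / ⟪a, a⟫) • b) +
      fderiv ℝ g z ⟨⟪w, a⟫ / ⟪a, a⟫, ⟪w, b⟫ / ⟪a, a⟫⟩ := by
    rw [clm_complex_apply]
    simp only [← ha, ← hb]
    abel
  conv_lhs => rw [key, normalPart_add, normalPart_eq_zero_iff.mpr ⟨_, rfl⟩, add_zero]
  refine Submodule.starProjection_eq_self_iff.mpr (mem_orthogonal_range.mpr ⟨?_, ?_⟩)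
  · rw [← ha, inner_sub_left, inner_sub_left, real_inner_smul_left, real_inner_smul_left, h3,
      div_mul_cancel₀ _ hE]
    simp
  · rw [← hb, inner_sub_left, inner_sub_left, real_inner_smul_left, real_inner_smul_left, h2, ← h1,
      div_mul_cancel₀ _ hE]
    simp

/-- The mean curvature vector of a conformal immersion is a multiple of its Laplacian. -/
theorem meanCurvature_eq : meanCurvature g z = (2 * firstFF g z 1 1)⁻¹ •
    (fderiv ℝ (fderiv ℝ g) z 1 1 + fderiv ℝ (fderiv ℝ g) z Complex.I Complex.I) := by
  have hE := (h.pos hz).ne'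
  -- The Laplacian is already normal: its tangential components cancel by the differentiated
  -- conformality relations.
  have h1 : normalPart g z
      (fderiv ℝ (fderiv ℝ g) z 1 1 + fderiv ℝ (fderiv ℝ g) z Complex.I Complex.I) =
      fderiv ℝ (fderiv ℝ g) z 1 1 + fderiv ℝ (fderiv ℝ g) z Complex.I Complex.I := by
    have e1 := h.conf_deriv hz 1
    have e2 := h.conf_deriv hz Complex.I
    have e3 := h.orth_deriv hz 1
    have e4 := h.orth_deriv hz Complex.I
    rw [h.symm hz Complex.I 1] at e2 e4
    refine Submodule.starProjection_eq_self_iff.mpr (mem_orthogonal_range.mpr ⟨?_, ?_⟩) <;>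
      rw [inner_add_left] <;> linarith
  rw [meanCurvature, ← h.conf z hz, h.orth z hz, ← h1, normalPart_add]
  simp only [secondFF, mul_zero, zero_smul, sub_zero]
  rw [← smul_add, smul_smul]
  congr 1
  field_simp
  simp

end IsConformalImmersionOn

/-! ### Totally real minimal surfaces in the sphere, in a conformal coordinate -/

/-- `f` is a conformal totally real minimal immersion of the open set `U` into `S⁶`. -/
structure IsTotallyRealMinimalOn (f : ℂ → E7) (U : Set ℂ) : Prop
    extends IsConformalImmersionOn f U where
  norm : ∀ z ∈ U, ⟪f z, f z⟫ = 1
  real : ∀ z ∈ U, ∀ X Y, ⟪cross7 (f z) (fderiv ℝ f z X), fderiv ℝ f z Y⟫ = 0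
  laplacian : ∀ z ∈ U, fderiv ℝ (fderiv ℝ f) z 1 1 +
    fderiv ℝ (fderiv ℝ f) z Complex.I Complex.I = -(2 * firstFF f z 1 1) • f z

/-- The unit normal `f_x × f_y / |f_x|²` of a totally real immersion with conformal parameter. -/
def crossNormal (f : ℂ → E7) (z : ℂ) : E7 :=
  (firstFF f z 1 1)⁻¹ • cross7 (fderiv ℝ f z 1) (fderiv ℝ f z Complex.I)

/-- The derivative of `crossNormal f` is `-f × *df`. -/
def CrossNormalIsDual (f : ℂ → E7) (U : Set ℂ) : Prop :=
  ∀ z ∈ U, ∀ X, fderiv ℝ (crossNormal f) z X = -cross7 (f z) (fderiv ℝ f z (Complex.I * X))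

/-- The left sides are tangent vectors of F^+ and F^-. Subtracting the equations leaves a relation
between the orthogonal vectors Jb, a, Ja, b, which gives u = u' = -1/2 and v = v' = 0. -/
theorem eq_neg_cross7_of_parallel {p a b N : E7} {E : ℝ} (h : IsTotallyRealFrame p a b E)
    {u v u' v' : ℝ}
    (h1 : u • (cross7 p b + a) + v • (-cross7 p a + b) = (2⁻¹ : ℝ) • (N - a))
    (h2 : u' • (cross7 p b - a) + v' • (-cross7 p a - b) = (2⁻¹ : ℝ) • (N + a)) :
    N = -cross7 p b := by
  have hE := h.pos.ne'
  have key : (u' - u) • cross7 p b - (u + u' + 1) • a - (v' - v) • cross7 p a - (v + v') • b =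
      0 := by
    have h3 : (u' • (cross7 p b - a) + v' • (-cross7 p a - b)) -
        (u • (cross7 p b + a) + v • (-cross7 p a + b)) - a = 0 := by
      rw [h1, h2]; module
    rw [← h3]; module
  have ha := h.ab
  rw [real_inner_comm] at ha
  have k1 := congrArg (fun w => ⟪w, cross7 p b⟫) key
  have k2 := congrArg (fun w => ⟪w, a⟫) key
  have k3 := congrArg (fun w => ⟪w, cross7 p a⟫) key
  have k4 := congrArg (fun w => ⟪w, b⟫) key
  have f1 := h.real; have f2 := h.inner_Jb_a; have f5 := inner_cross7_right p a
  have f6 := inner_cross7_right p b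
  rw [real_inner_comm] at f1 f2 f5 f6
  have e4 := h.inner_Ja_Jb
  rw [real_inner_comm] at e4
  simp only [inner_sub_left, real_inner_smul_left, inner_zero_left, h.inner_Jb_Jb, h.inner_Ja_Ja,
    f1, f2, f5, f6, h.inner_Ja_Jb, e4, h.real, h.inner_Jb_a, inner_cross7_right, h.aa, h.bb, h.ab,
    ha, mul_zero, sub_zero, zero_sub, neg_eq_zero, mul_eq_zero, hE, or_false] at k1 k2 k3 k4
  have hu : u = -2⁻¹ := by linarith
  have hv : v = 0 := by linarith
  subst hu hv
  have h3 := congrArg (fun w => (2 : ℝ) • w) h1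
  simp only [smul_smul] at h3
  norm_num at h3
  rw [eq_sub_iff_add_eq] at h3
  rw [← h3]
  module

namespace IsTotallyRealMinimalOn

variable {f : ℂ → E7} {U : Set ℂ} {z : ℂ} (h : IsTotallyRealMinimalOn f U) (hz : z ∈ U)
include h hz

theorem hasFDerivAt : HasFDerivAt f (fderiv ℝ f z) z := h.toIsConformalImmersionOn.hasFDerivAt hz

theorem inner_point_fderiv (X : ℂ) : ⟪f z, fderiv ℝ f z X⟫ = 0 := by
  have h1 := inner_fderiv_eq_zero h.isOpen hz (h.hasFDerivAt hz) (h.hasFDerivAt hz) h.norm X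
  rw [real_inner_comm (f z)] at h1
  linarith

theorem frame : IsTotallyRealFrame (f z) (fderiv ℝ f z 1) (fderiv ℝ f z Complex.I)
    (firstFF f z 1 1) where
  pos := h.pos hz
  pp := h.norm z hz
  pa := h.inner_point_fderiv hz 1
  pb := h.inner_point_fderiv hz Complex.I
  aa := rfl
  bb := (h.conf z hz).symm
  ab := h.orth z hz
  real := h.real z hz _ _

theorem inner_snd_point (X Y : ℂ) : ⟪f z, fderiv ℝ (fderiv ℝ f) z X Y⟫ =
    -⟪fderiv ℝ f z X, fderiv ℝ f z Y⟫ := by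
  have h1 := inner_fderiv_eq_zero h.isOpen hz (h.hasFDerivAt hz) (h.hasFDerivAt_fderiv hz Y)
    (fun w hw => h.inner_point_fderiv hw Y) X
  simp only [ContinuousLinearMap.flip_apply] at h1
  linarith

theorem hasFDerivAt_J (X : ℂ) : HasFDerivAt (fun w => cross7 (f w) (fderiv ℝ f w X))
    ((crossL (f z)).comp ((fderiv ℝ (fderiv ℝ f) z).flip X) +
      (crossL.flip (fderiv ℝ f z X)).comp (fderiv ℝ f z)) z :=
  (h.hasFDerivAt hz).cross7 (h.hasFDerivAt_fderiv hz X)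

/-- The derivative of the totally real condition. When X = Z the triple product drops out, which
makes ⟨f_XY, J f_Z⟩ symmetric in all its arguments. -/
theorem inner_snd_J_symm (X Y Z : ℂ) :
    ⟪fderiv ℝ (fderiv ℝ f) z X Y, cross7 (f z) (fderiv ℝ f z Z)⟫ +
    ⟪cross7 (fderiv ℝ f z X) (fderiv ℝ f z Z), fderiv ℝ f z Y⟫ =
    ⟪fderiv ℝ (fderiv ℝ f) z X Z, cross7 (f z) (fderiv ℝ f z Y)⟫ := by
  have h1 := inner_fderiv_eq_zero h.isOpen hz (h.hasFDerivAt_J hz Z) (h.hasFDerivAt_fderiv hz Y)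
    (fun w hw => h.real w hw Z Y) X
  simp only [ContinuousLinearMap.flip_apply, add_apply, crossL_apply, inner_add_left,
    ContinuousLinearMap.comp_apply] at h1
  rw [inner_cross7_skew (f z) (fderiv ℝ (fderiv ℝ f) z X Z),
    real_inner_comm (fderiv ℝ (fderiv ℝ f) z X Y)] at h1
  linarith

theorem differentiableAt_crossNormal : DifferentiableAt ℝ (crossNormal f) z := by
  have h1 : DifferentiableAt ℝ (fun w => firstFF f w 1 1) z :=
    ((h.hasFDerivAt_fderiv hz 1).inner ℝ (h.hasFDerivAt_fderiv hz 1)).differentiableAt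
  exact (h1.inv (h.pos hz).ne').smul ((h.hasFDerivAt_fderiv hz 1).cross7
    (h.hasFDerivAt_fderiv hz Complex.I)).differentiableAt

/-- The derivative of `G + s f`, where `dG = f × *df`. -/
theorem fderiv_associated {G : ℂ → E7} (hG : ContDiffOn ℝ ∞ G U)
    (hGf : ∀ w ∈ U, ∀ X, fderiv ℝ G w X = cross7 (f w) (fderiv ℝ f w (Complex.I * X)))
    (s : ℝ) (X : ℂ) : fderiv ℝ (fun w => G w + s • f w) z X =
      cross7 (f z) (fderiv ℝ f z (Complex.I * X)) + s • fderiv ℝ f z X := by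
  rw [((hG.hasFDerivAt_of_isOpen h.isOpen hz).fun_add ((h.hasFDerivAt hz).fun_const_smul s)).fderiv]
  simp [hGf z hz]

end IsTotallyRealMinimalOn

/-! ### The associated surfaces G ± f and their mean curvature. -/

section Associated

variable {f G : ℂ → E7} {U : Set ℂ} (h : IsTotallyRealMinimalOn f U) (hG : ContDiffOn ℝ ∞ G U)
  (hGf : ∀ w ∈ U, ∀ X, fderiv ℝ G w X = cross7 (f w) (fderiv ℝ f w (Complex.I * X)))
include h hG hGf

theorem associated_fderiv {z : ℂ} (hz : z ∈ U) (s : ℝ) :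
    fderiv ℝ (fun w => G w + s • f w) z 1 =
        cross7 (f z) (fderiv ℝ f z Complex.I) + s • fderiv ℝ f z 1 ∧
      fderiv ℝ (fun w => G w + s • f w) z Complex.I =
        -cross7 (f z) (fderiv ℝ f z 1) + s • fderiv ℝ f z Complex.I := by
  constructor
  · rw [h.fderiv_associated hz hG hGf, mul_one]
  · rw [h.fderiv_associated hz hG hGf, Complex.I_mul_I, map_neg, cross7_neg_right]

/-- The parts f × *df and s df are both conformal with the factor of f, and total reality makes them
orthogonal to each other; the first fundamental form is therefore doubled. -/
theorem associated_isConformalImmersionOn {s : ℝ} (hs : s ^ 2 = 1) :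
    IsConformalImmersionOn (fun w => G w + s • f w) U := by
  have key : ∀ z ∈ U, firstFF (fun w => G w + s • f w) z 1 1 = 2 * firstFF f z 1 1 ∧
      firstFF (fun w => G w + s • f w) z Complex.I Complex.I = 2 * firstFF f z 1 1 ∧
      firstFF (fun w => G w + s • f w) z 1 Complex.I = 0 := by
    intro z hz
    have hf := h.frame hz
    obtain ⟨e1, e2⟩ := associated_fderiv h hG hGf hz s
    have f1 := hf.inner_Jb_a
    have f3 := inner_cross7_right (f z) (fderiv ℝ f z 1)
    have f4 := hf.inner_Ja_Jb
    rw [real_inner_comm] at f1 f3 f4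
    have f2 := hf.real
    rw [real_inner_comm] at f2
    refine ⟨?_, ?_, ?_⟩ <;> rw [firstFF] <;> simp only [e1, e2] <;>
      simp only [inner_add_left, inner_add_right, real_inner_smul_left, real_inner_smul_right,
        inner_neg_left, inner_neg_right, hf.inner_Ja_Ja, hf.inner_Jb_Jb, f4, f3, f1, f2, hf.real,
        hf.inner_Jb_a, inner_cross7_right, hf.aa, hf.bb, hf.ab] <;>
      first | linear_combination firstFF f z 1 1 * hs | ring
  refine ⟨h.isOpen, hG.add (h.smooth.const_smul s), fun z hz => ?_,
    fun z hz => (key z hz).1.trans (key z hz).2.1.symm, fun z hz => (key z hz).2.2⟩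
  obtain ⟨k1, k2, k3⟩ := key z hz
  have hpos := h.pos hz
  refine (injective_iff_map_eq_zero _).mpr fun X hX => ?_
  rw [clm_complex_apply] at hX
  simp only [firstFF] at k1 k2 k3
  have k4 := k3
  rw [real_inner_comm] at k4
  have h1 := congrArg (fun w => ⟪w, fderiv ℝ (fun w => G w + s • f w) z 1⟫) hX
  have h2 := congrArg (fun w => ⟪w, fderiv ℝ (fun w => G w + s • f w) z Complex.I⟫) hX
  simp only [firstFF] at hpos
  simp only [inner_add_left, real_inner_smul_left, k1, k2, k3, k4, inner_zero_left, mul_zero,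
    add_zero, zero_add, mul_eq_zero, hpos.ne', or_false, two_ne_zero] at h1 h2
  exact Complex.ext h1 h2

/-- In the Laplacian of G the terms with f_xy cancel and leave 2 f_x × f_y; that of s f is -2E s f.
The factor (2 · 2E)⁻¹ accounts for the doubled metric. -/
theorem associated_meanCurvature {s : ℝ} (hs : s ^ 2 = 1) {z : ℂ} (hz : z ∈ U) :
    meanCurvature (fun w => G w + s • f w) z = (2⁻¹ : ℝ) • (crossNormal f z - s • f z) := by
  have hg := associated_isConformalImmersionOn h hG hGf hs
  have hf := h.frame hz
  obtain ⟨e1, e2⟩ := associated_fderiv h hG hGf hz s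
  have hE : firstFF (fun w => G w + s • f w) z 1 1 = 2 * firstFF f z 1 1 := by
    rw [firstFF]
    have f1 := hf.inner_Jb_a
    rw [real_inner_comm] at f1
    simp only [e1]
    simp only [inner_add_left, inner_add_right, real_inner_smul_left, real_inner_smul_right,
      hf.inner_Jb_Jb, f1, hf.inner_Jb_a, hf.aa]
    linear_combination firstFF f z 1 1 * hs
  have snd : ∀ X Y : ℂ, fderiv ℝ (fderiv ℝ (fun w => G w + s • f w)) z X Y =
      cross7 (f z) (fderiv ℝ (fderiv ℝ f) z X (Complex.I * Y)) +
        cross7 (fderiv ℝ f z X) (fderiv ℝ f z (Complex.I * Y)) +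
          s • fderiv ℝ (fderiv ℝ f) z X Y := by
    intro X Y
    have k1 := hg.hasFDerivAt_fderiv hz Y
    have k2 := ((h.hasFDerivAt_J hz (Complex.I * Y)).add
      ((h.hasFDerivAt_fderiv hz Y).const_smul s)).congr_of_eventuallyEq
      (Filter.eventually_of_mem (h.isOpen.mem_nhds hz) fun w hw =>
        h.fderiv_associated hw hG hGf s Y)
    simpa using
      congrArg (fun L : ℂ →L[ℝ] E7 => L X) (k1.unique k2)
  have lap := h.laplacian z hz
  rw [hg.meanCurvature_eq hz, hE, snd, snd, mul_one, Complex.I_mul_I, map_neg, map_neg,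
    cross7_neg_right, cross7_neg_right, h.symm hz Complex.I 1, crossNormal,
    cross7_anticomm (fderiv ℝ f z Complex.I)]
  have hE0 := (h.pos hz).ne'
  rw [← eq_sub_iff_add_eq] at lap
  rw [lap]
  set E := firstFF f z 1 1
  have e3 : (2 * (2 * E))⁻¹ * (2 * E) = 2⁻¹ := by field_simp
  have e4 : (2 * (2 * E))⁻¹ * 2 = 2⁻¹ * E⁻¹ := by field_simp
  generalize cross7 (fderiv ℝ f z 1) (fderiv ℝ f z Complex.I) = n
  generalize cross7 (f z) (fderiv ℝ (fderiv ℝ f) z 1 Complex.I) = m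
  trans ((2 * (2 * E))⁻¹ * 2) • n - (s * ((2 * (2 * E))⁻¹ * (2 * E))) • f z
  · module
  · rw [e3, e4]; module

/-- Both associated surfaces have parallel mean curvature if and only if the unit normal
`f_x × f_y / |f_x|²` and `-G` have the same derivative. -/
theorem associated_parallel_iff :
    (∀ s : ℝ, s ^ 2 = 1 → ∀ z ∈ U, ∀ X, normalPart (fun w => G w + s • f w) z
      (fderiv ℝ (meanCurvature (fun w => G w + s • f w)) z X) = 0) ↔ CrossNormalIsDual f U := by
  have hH : ∀ s : ℝ, s ^ 2 = 1 → ∀ z ∈ U, ∀ X,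
      fderiv ℝ (meanCurvature (fun w => G w + s • f w)) z X =
        (2⁻¹ : ℝ) • (fderiv ℝ (crossNormal f) z X - s • fderiv ℝ f z X) := by
    intro s hs z hz X
    have k := ((h.differentiableAt_crossNormal hz).hasFDerivAt.sub
      ((h.hasFDerivAt hz).const_smul s)).const_smul (2⁻¹ : ℝ)
    rw [(k.congr_of_eventuallyEq (Filter.eventually_of_mem (h.isOpen.mem_nhds hz) fun w hw =>
      associated_meanCurvature h hG hGf hs hw)).fderiv]
    simp
  constructor
  · intro hP z hz
    have hf := h.frame hz
    have aux : ∀ X, ∃ u v u' v' : ℝ,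
        u • (cross7 (f z) (fderiv ℝ f z Complex.I) + fderiv ℝ f z 1) +
          v • (-cross7 (f z) (fderiv ℝ f z 1) + fderiv ℝ f z Complex.I) =
          (2⁻¹ : ℝ) • (fderiv ℝ (crossNormal f) z X - fderiv ℝ f z X) ∧
        u' • (cross7 (f z) (fderiv ℝ f z Complex.I) - fderiv ℝ f z 1) +
          v' • (-cross7 (f z) (fderiv ℝ f z 1) - fderiv ℝ f z Complex.I) =
          (2⁻¹ : ℝ) • (fderiv ℝ (crossNormal f) z X + fderiv ℝ f z X) := by
      intro X
      obtain ⟨Y, hY⟩ := IsConformalImmersionOn.normalPart_eq_zero_iff.mp (hP 1 (by norm_num) z hz X)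
      obtain ⟨Z, hZ⟩ := IsConformalImmersionOn.normalPart_eq_zero_iff.mp
        (hP (-1) (by norm_num) z hz X)
      rw [hH _ (by norm_num) z hz, clm_complex_apply, (associated_fderiv h hG hGf hz _).1,
        (associated_fderiv h hG hGf hz _).2] at hY hZ
      refine ⟨Y.re, Y.im, Z.re, Z.im, ?_, ?_⟩
      · simpa using hY
      · simpa [sub_eq_add_neg] using hZ
    have h1 : fderiv ℝ (crossNormal f) z 1 = -cross7 (f z) (fderiv ℝ f z Complex.I) := by
      obtain ⟨u, v, u', v', e1, e2⟩ := aux 1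
      exact eq_neg_cross7_of_parallel hf e1 e2
    have h2 : fderiv ℝ (crossNormal f) z Complex.I = cross7 (f z) (fderiv ℝ f z 1) := by
      obtain ⟨u, v, u', v', e1, e2⟩ := aux Complex.I
      have hf' := hf.swap
      -- Turning the frame by a right angle, (a, b) to (b, -a), reduces the y-derivative to the case
      -- of the x-derivative.
      have hf'' : IsTotallyRealFrame (f z) (fderiv ℝ f z Complex.I) (-fderiv ℝ f z 1)
          (firstFF f z 1 1) := by
        refine ⟨hf.pos, hf.pp, hf.pb, ?_, hf.bb, ?_, ?_, ?_⟩
        · rw [inner_neg_right, hf.pa, neg_zero]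
        · rw [inner_neg_neg, hf.aa]
        · rw [inner_neg_right, hf'.ab, neg_zero]
        · rw [inner_neg_right, hf'.real, neg_zero]
      have := eq_neg_cross7_of_parallel (N := fderiv ℝ (crossNormal f) z Complex.I) hf'' (u := v) (v := -u)
        (u' := v') (v' := -u') (by rw [cross7_neg_right, ← e1]; module)
        (by rw [cross7_neg_right, ← e2]; module)
      rw [this, cross7_neg_right, neg_neg]
    intro X
    rw [clm_complex_apply, clm_complex_apply_I_mul, h1, h2, cross7_add_right, cross7_smul_right,
      cross7_smul_right]
    module
  · intro hD s hs z hz X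
    rw [IsConformalImmersionOn.normalPart_eq_zero_iff]
    -- If dN = -dG, the derivative of ½(N - s f) is -½ d(G + s f), which is tangent.
    refine ⟨-(2⁻¹ : ℝ) • X, ?_⟩
    rw [map_smul, h.fderiv_associated hz hG hGf, hH s hs z hz X, hD z hz]
    module

end Associated

/-! ### The axis J N and the derivative of the unit normal. -/

/-- The vector `J N`, where `N` is the unit normal `crossNormal f`. -/
def crossAxis (f : ℂ → E7) (z : ℂ) : E7 := cross7 (f z) (crossNormal f z)

namespace IsTotallyRealMinimalOn

variable {f : ℂ → E7} {U : Set ℂ} {z : ℂ} (h : IsTotallyRealMinimalOn f U) (hz : z ∈ U)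
include h hz

theorem smul_crossNormal : firstFF f z 1 1 • crossNormal f z =
    cross7 (fderiv ℝ f z 1) (fderiv ℝ f z Complex.I) :=
  smul_inv_smul₀ (h.pos hz).ne' _

omit h hz in
theorem crossAxis_eq : crossAxis f z = (firstFF f z 1 1)⁻¹ •
    cross7 (f z) (cross7 (fderiv ℝ f z 1) (fderiv ℝ f z Complex.I)) := by
  rw [crossAxis, crossNormal, cross7_smul_right]

theorem inner_crossNormal_self : ⟪crossNormal f z, crossNormal f z⟫ = 1 := by
  have hE := (h.pos hz).ne'
  rw [crossNormal, real_inner_smul_left, real_inner_smul_right, (h.frame hz).inner_normal_normal]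
  field_simp

theorem inner_crossNormal_point : ⟪crossNormal f z, f z⟫ = 0 := by
  rw [crossNormal, real_inner_smul_left, (h.frame hz).inner_normal_point, mul_zero]

theorem inner_crossAxis_self : ⟪crossAxis f z, crossAxis f z⟫ = 1 := by
  rw [crossAxis, inner_cross7_cross7, h.norm z hz, h.inner_crossNormal_self hz, real_inner_comm,
    h.inner_crossNormal_point hz]
  ring

omit h hz in
theorem inner_crossAxis_point : ⟪crossAxis f z, f z⟫ = 0 := inner_cross7_left _ _

theorem inner_crossAxis_fderiv (X : ℂ) : ⟪crossAxis f z, fderiv ℝ f z X⟫ = 0 := by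
  rw [crossAxis_eq, clm_complex_apply _ X, real_inner_smul_left, inner_add_right,
    real_inner_smul_right, real_inner_smul_right, (h.frame hz).inner_Jnormal_a,
    (h.frame hz).inner_Jnormal_b]
  ring

theorem cross7_crossAxis_point : cross7 (crossAxis f z) (f z) = crossNormal f z := by
  rw [cross7_anticomm, crossAxis, cross7_cross7_self, real_inner_comm,
    h.inner_crossNormal_point hz, h.norm z hz]
  module

/-- Read off from v × a = -Jb and v × b = Ja, where v is the axis. It turns J into the product with
v, which is what makes the rotated surface almost complex. -/
theorem cross7_crossAxis_fderiv (X : ℂ) : cross7 (crossAxis f z) (fderiv ℝ f z X) =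
    -cross7 (f z) (fderiv ℝ f z (Complex.I * X)) := by
  have hE := (h.pos hz).ne'
  rw [crossAxis_eq, clm_complex_apply _ X, clm_complex_apply_I_mul]
  simp only [cross7_smul_left, cross7_add_right, cross7_smul_right,
    (h.frame hz).cross_Jnormal_a, (h.frame hz).cross_Jnormal_b, smul_neg]
  rw [inv_smul_smul₀ hE, inv_smul_smul₀ hE]
  module

/-- In d(f × N) the term f × dN equals *df because f × (f × u) = -u for u tangent, while a × N = -b
and b × N = a make df × N equal to -*df. -/
theorem fderiv_crossAxis (hD : CrossNormalIsDual f U) : fderiv ℝ (crossAxis f) z = 0 := by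
  have hE := (h.pos hz).ne'
  have key : ∀ X, fderiv ℝ (crossAxis f) z X =
      fderiv ℝ f z (Complex.I * X) + cross7 (fderiv ℝ f z X) (crossNormal f z) := by
    intro X
    have k := ((h.hasFDerivAt hz).cross7 (h.differentiableAt_crossNormal hz).hasFDerivAt).fderiv
    refine (congrArg (fun L : ℂ →L[ℝ] E7 => L X) k).trans ?_
    simp only [add_apply, ContinuousLinearMap.comp_apply, ContinuousLinearMap.flip_apply,
      crossL_apply]
    rw [hD z hz, cross7_neg_right, cross7_cross7_self, h.inner_point_fderiv hz, h.norm z hz]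
    module
  have h1 : fderiv ℝ (crossAxis f) z 1 = 0 := by
    rw [key, crossNormal, cross7_smul_right, (h.frame hz).cross_a_normal, mul_one, smul_neg,
      inv_smul_smul₀ hE, add_neg_cancel]
  have h2 : fderiv ℝ (crossAxis f) z Complex.I = 0 := by
    rw [key, crossNormal, cross7_smul_right, (h.frame hz).cross_b_normal, Complex.I_mul_I,
      inv_smul_smul₀ hE, map_neg, neg_add_cancel]
  ext1 X
  rw [clm_complex_apply, h1, h2]
  simp

theorem differentiableAt_crossAxis : DifferentiableAt ℝ (crossAxis f) z :=
  ((h.hasFDerivAt hz).cross7 (h.differentiableAt_crossNormal hz).hasFDerivAt).differentiableAt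

/-- The second fundamental form in the sphere, as a second derivative with its tangential and
radial parts removed. -/
theorem secondFF_sphere_eq (X Y : ℂ) :
    secondFF f z X Y - ⟪secondFF f z X Y, f z⟫ • f z =
      fderiv ℝ (fderiv ℝ f) z X Y -
        (⟪fderiv ℝ (fderiv ℝ f) z X Y, f z⟫ • f z +
        (⟪fderiv ℝ (fderiv ℝ f) z X Y, fderiv ℝ f z 1⟫ / firstFF f z 1 1) • fderiv ℝ f z 1 +
        (⟪fderiv ℝ (fderiv ℝ f) z X Y, fderiv ℝ f z Complex.I⟫ / firstFF f z 1 1) •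
          fderiv ℝ f z Complex.I) := by
  rw [secondFF, h.normalPart_eq hz, inner_sub_left, inner_sub_left, real_inner_smul_left,
    real_inner_smul_left, real_inner_comm (f z) (fderiv ℝ f z 1),
    real_inner_comm (f z) (fderiv ℝ f z Complex.I), h.inner_point_fderiv hz,
    h.inner_point_fderiv hz]
  module

/-- For a totally geodesic `f`, the derivative of the unit normal is `-f × *df`. -/
theorem fderiv_crossNormal_of_geodesic
    (hg : ∀ X Y, secondFF f z X Y - ⟪secondFF f z X Y, f z⟫ • f z = 0) (X : ℂ) :
    fderiv ℝ (crossNormal f) z X = -cross7 (f z) (fderiv ℝ f z (Complex.I * X)) := by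
  have hf := h.frame hz
  have hE := (h.pos hz).ne'
  have hP : ∀ Y, ∃ s t : ℝ, fderiv ℝ (fderiv ℝ f) z X Y =
      -⟪fderiv ℝ f z X, fderiv ℝ f z Y⟫ • f z + s • fderiv ℝ f z 1 +
        t • fderiv ℝ f z Complex.I := by
    intro Y
    have h1 := hg X Y
    rw [h.secondFF_sphere_eq hz, sub_eq_zero, real_inner_comm (f z), h.inner_snd_point hz] at h1
    exact ⟨_, _, h1⟩
  -- This differentiates E N = f_x × f_y; the constant c is the derivative of E.
  have hN : ∃ c : ℝ, firstFF f z 1 1 • fderiv ℝ (crossNormal f) z X + c • crossNormal f z =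
      cross7 (fderiv ℝ f z 1) (fderiv ℝ (fderiv ℝ f) z X Complex.I) +
        cross7 (fderiv ℝ (fderiv ℝ f) z X 1) (fderiv ℝ f z Complex.I) := by
    have k1 := ((h.hasFDerivAt_fderiv hz 1).inner ℝ (h.hasFDerivAt_fderiv hz 1)).smul
      (h.differentiableAt_crossNormal hz).hasFDerivAt
    have k2 := ((h.hasFDerivAt_fderiv hz 1).cross7
      (h.hasFDerivAt_fderiv hz Complex.I)).congr_of_eventuallyEq
      (Filter.eventually_of_mem (h.isOpen.mem_nhds hz) fun w hw => h.smul_crossNormal hw)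
    have k3 := congrArg (fun L : ℂ →L[ℝ] E7 => L X) (k1.unique k2)
    simp only [add_apply, ContinuousLinearMap.comp_apply, ContinuousLinearMap.flip_apply,
      crossL_apply] at k3
    exact ⟨_, k3⟩
  have hNN := inner_fderiv_eq_zero h.isOpen hz
    (h.differentiableAt_crossNormal hz).hasFDerivAt (h.differentiableAt_crossNormal hz).hasFDerivAt
    (fun w hw => h.inner_crossNormal_self hw) X
  rw [real_inner_comm (crossNormal f z)] at hNN
  obtain ⟨s, t, e1⟩ := hP 1
  obtain ⟨s', t', e2⟩ := hP Complex.I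
  obtain ⟨c, hc⟩ := hN
  have hX1 : ⟪fderiv ℝ f z X, fderiv ℝ f z 1⟫ = X.re * firstFF f z 1 1 := by
    rw [clm_complex_apply (fderiv ℝ f z) X, inner_add_left, real_inner_smul_left,
      real_inner_smul_left, hf.swap.ab, hf.aa]
    ring
  have hX2 : ⟪fderiv ℝ f z X, fderiv ℝ f z Complex.I⟫ = X.im * firstFF f z 1 1 := by
    rw [clm_complex_apply (fderiv ℝ f z) X, inner_add_left, real_inner_smul_left,
      real_inner_smul_left, hf.ab, hf.bb]
    ring
  have key : ∃ d : ℝ, firstFF f z 1 1 • fderiv ℝ (crossNormal f) z X = d • crossNormal f z -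
      firstFF f z 1 1 • cross7 (f z) (fderiv ℝ f z (Complex.I * X)) := by
    refine ⟨(s + t') * firstFF f z 1 1 - c, ?_⟩
    rw [eq_sub_of_add_eq hc, e1, e2, hX1, hX2, clm_complex_apply_I_mul]
    simp only [cross7_add_left, cross7_add_right, cross7_smul_left, cross7_smul_right,
      cross7_self, cross7_anticomm (fderiv ℝ f z 1) (f z), ← h.smul_crossNormal hz]
    module
  obtain ⟨d, hd⟩ := key
  have hJ : ⟪crossNormal f z, cross7 (f z) (fderiv ℝ f z (Complex.I * X))⟫ = 0 := by
    rw [clm_complex_apply, cross7_add_right, cross7_smul_right, cross7_smul_right, crossNormal]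
    simp only [inner_add_right, real_inner_smul_left, real_inner_smul_right, hf.inner_normal_Ja,
      hf.inner_normal_Jb]
    ring
  have h3 := congrArg (fun w => ⟪crossNormal f z, w⟫) hd
  simp only [inner_sub_right, real_inner_smul_right, hJ, h.inner_crossNormal_self hz] at h3
  -- All multiples of N were collected in d; they vanish because |N| = 1 makes dN orthogonal to N.
  have hd0 : d = 0 := by
    have : ⟪crossNormal f z, fderiv ℝ (crossNormal f) z X⟫ = 0 := by
      linarith
    rw [this] at h3
    linarith
  rw [hd0, zero_smul, zero_sub, ← smul_neg] at hd
  exact smul_right_injective E7 hE hd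

end IsTotallyRealMinimalOn

/-! ### The second fundamental form when the axis is constant. -/

section Axis

variable {f : ℂ → E7} {U : Set ℂ} (h : IsTotallyRealMinimalOn f U) {v : E7}
  (hv : ∀ z ∈ U, crossAxis f z = v)
include h hv

theorem axis_inner_snd {z : ℂ} (hz : z ∈ U) (X Y : ℂ) :
    ⟪fderiv ℝ (fderiv ℝ f) z X Y, v⟫ = 0 := by
  have h1 := inner_fderiv_eq_zero h.isOpen hz (h.hasFDerivAt_fderiv hz Y) (hasFDerivAt_const v z)
    (c := 0) (fun w hw => by rw [← hv w hw, real_inner_comm, h.inner_crossAxis_fderiv hw]) X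
  simpa using h1

/-- Here N = v × f with v constant, so differentiating ⟨f_Y, N⟩ = 0 leaves ⟨f_Y, v × f_X⟩ = -⟨f_Y, J
f_{iX}⟩, which is zero by total reality. -/
theorem axis_inner_snd_normal {z : ℂ} (hz : z ∈ U) (X Y : ℂ) :
    ⟪fderiv ℝ (fderiv ℝ f) z X Y, crossNormal f z⟫ = 0 := by
  have h1 := inner_fderiv_eq_zero h.isOpen hz (h.hasFDerivAt_fderiv hz Y)
    ((hasFDerivAt_const v z).cross7 (h.hasFDerivAt hz)) (c := 0) (fun w hw => by
      rw [← hv w hw, h.cross7_crossAxis_point hw, crossNormal, real_inner_smul_right,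
        clm_complex_apply, inner_add_left, real_inner_smul_left, real_inner_smul_left,
        real_inner_comm, inner_cross7_left, real_inner_comm, inner_cross7_right]
      ring) X
  simp only [ContinuousLinearMap.flip_apply, add_apply, ContinuousLinearMap.comp_apply,
    crossL_apply, zero_apply, cross7_zero_left, add_zero] at h1
  rw [← hv z hz, h.cross7_crossAxis_fderiv hz, h.cross7_crossAxis_point hz, inner_neg_right,
    real_inner_comm, h.real z hz] at h1
  linarith

theorem axis_snd_expand {z : ℂ} (hz : z ∈ U) (X Y : ℂ) :
    fderiv ℝ (fderiv ℝ f) z X Y = ⟪fderiv ℝ (fderiv ℝ f) z X Y, f z⟫ • f z +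
      (⟪fderiv ℝ (fderiv ℝ f) z X Y, fderiv ℝ f z 1⟫ / firstFF f z 1 1) • fderiv ℝ f z 1 +
      (⟪fderiv ℝ (fderiv ℝ f) z X Y, fderiv ℝ f z Complex.I⟫ / firstFF f z 1 1) •
        fderiv ℝ f z Complex.I +
      (⟪fderiv ℝ (fderiv ℝ f) z X Y, cross7 (f z) (fderiv ℝ f z 1)⟫ / firstFF f z 1 1) •
        cross7 (f z) (fderiv ℝ f z 1) +
      (⟪fderiv ℝ (fderiv ℝ f) z X Y, cross7 (f z) (fderiv ℝ f z Complex.I)⟫ / firstFF f z 1 1) •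
        cross7 (f z) (fderiv ℝ f z Complex.I) := by
  refine (h.frame hz).expand ?_ ?_
  · rw [← h.smul_crossNormal hz, real_inner_smul_right, axis_inner_snd_normal h hv hz, mul_zero]
  · rw [← h.smul_crossNormal hz, cross7_smul_right, real_inner_smul_right, ← crossAxis, hv z hz,
      axis_inner_snd h hv hz, mul_zero]

end Axis

namespace IsTotallyRealMinimalOn

variable {f : ℂ → E7} {U : Set ℂ} {z : ℂ} (h : IsTotallyRealMinimalOn f U) (hz : z ∈ U)
include h hz

/-- With the next two lemmas: the cubic form ⟨f_XY, J f_Z⟩ is symmetric and trace-free, so it is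
determined by A = ⟨f_xx, J f_x⟩ and B = ⟨f_xx, J f_y⟩. -/
theorem snd_J_one_I_one : ⟪fderiv ℝ (fderiv ℝ f) z 1 Complex.I, cross7 (f z) (fderiv ℝ f z 1)⟫ =
    ⟪fderiv ℝ (fderiv ℝ f) z 1 1, cross7 (f z) (fderiv ℝ f z Complex.I)⟫ := by
  have h1 := h.inner_snd_J_symm hz 1 Complex.I 1
  rwa [cross7_self, inner_zero_left, add_zero] at h1

theorem snd_J_I_I (X : ℂ) : ⟪fderiv ℝ (fderiv ℝ f) z Complex.I Complex.I,
    cross7 (f z) (fderiv ℝ f z X)⟫ =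
    -⟪fderiv ℝ (fderiv ℝ f) z 1 1, cross7 (f z) (fderiv ℝ f z X)⟫ := by
  have h1 := congrArg (fun w => ⟪w, cross7 (f z) (fderiv ℝ f z X)⟫) (h.laplacian z hz)
  simp only [inner_add_left, real_inner_smul_left] at h1
  rw [real_inner_comm (cross7 (f z) (fderiv ℝ f z X)) (f z), inner_cross7_left] at h1
  linarith

theorem snd_J_one_I_I : ⟪fderiv ℝ (fderiv ℝ f) z 1 Complex.I,
    cross7 (f z) (fderiv ℝ f z Complex.I)⟫ =
    -⟪fderiv ℝ (fderiv ℝ f) z 1 1, cross7 (f z) (fderiv ℝ f z 1)⟫ := by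
  have h1 := h.inner_snd_J_symm hz Complex.I 1 Complex.I
  rw [cross7_self, inner_zero_left, add_zero, h.snd_J_I_I hz, h.symm hz Complex.I 1] at h1
  exact h1

end IsTotallyRealMinimalOn

section Axis

variable {f : ℂ → E7} {U : Set ℂ} (h : IsTotallyRealMinimalOn f U) {v : E7}
  (hv : ∀ z ∈ U, crossAxis f z = v)
include h hv

theorem axis_geodesic_of_cubic_eq_zero {z : ℂ} (hz : z ∈ U)
    (hA : ⟪fderiv ℝ (fderiv ℝ f) z 1 1, cross7 (f z) (fderiv ℝ f z 1)⟫ = 0)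
    (hB : ⟪fderiv ℝ (fderiv ℝ f) z 1 1, cross7 (f z) (fderiv ℝ f z Complex.I)⟫ = 0) (X Y : ℂ) :
    secondFF f z X Y - ⟪secondFF f z X Y, f z⟫ • f z = 0 := by
  have hXY : fderiv ℝ (fderiv ℝ f) z X Y = (X.re * Y.re) • fderiv ℝ (fderiv ℝ f) z 1 1 +
      (X.re * Y.im + X.im * Y.re) • fderiv ℝ (fderiv ℝ f) z 1 Complex.I +
      (X.im * Y.im) • fderiv ℝ (fderiv ℝ f) z Complex.I Complex.I := by
    rw [clm_complex_apply (fderiv ℝ (fderiv ℝ f) z X) Y, clm_complex_apply _ X]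
    simp only [add_apply, smul_apply]
    rw [h.symm hz Complex.I 1]
    module
  have h1 : ⟪fderiv ℝ (fderiv ℝ f) z X Y, cross7 (f z) (fderiv ℝ f z 1)⟫ = 0 := by
    rw [hXY]
    simp only [inner_add_left, real_inner_smul_left, h.snd_J_one_I_one hz, h.snd_J_I_I hz, hA, hB]
    ring
  have h2 : ⟪fderiv ℝ (fderiv ℝ f) z X Y, cross7 (f z) (fderiv ℝ f z Complex.I)⟫ = 0 := by
    rw [hXY]
    simp only [inner_add_left, real_inner_smul_left, h.snd_J_one_I_I hz, h.snd_J_I_I hz, hA, hB]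
    ring
  rw [h.secondFF_sphere_eq hz, sub_eq_zero]
  conv_lhs => rw [axis_snd_expand h hv hz X Y, h1, h2]
  simp

/-- If the image of `f` lies in a subspace of codimension two, then `f` is totally geodesic. -/
theorem axis_geodesic_of_degenerate {w : E7} (hw0 : w ≠ 0) (hwv : ⟪w, v⟫ = 0)
    (hw : ∀ z ∈ U, ⟪w, f z⟫ = 0) {z : ℂ} (hz : z ∈ U) (X Y : ℂ) :
    secondFF f z X Y - ⟪secondFF f z X Y, f z⟫ • f z = 0 := by
  have hD : ∀ z ∈ U, ∀ X, ⟪w, fderiv ℝ f z X⟫ = 0 := fun z hz X => by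
    simpa using inner_fderiv_eq_zero h.isOpen hz (hasFDerivAt_const w z) (h.hasFDerivAt hz) hw X
  have hP : ∀ z ∈ U, ∀ X Y, ⟪w, fderiv ℝ (fderiv ℝ f) z X Y⟫ = 0 := fun z hz X Y => by
    simpa using inner_fderiv_eq_zero h.isOpen hz (hasFDerivAt_const w z)
      (h.hasFDerivAt_fderiv hz Y) (fun z hz => hD z hz Y) X
  set Q : ℂ → ℝ := fun z =>
    ⟪fderiv ℝ (fderiv ℝ f) z 1 1, cross7 (f z) (fderiv ℝ f z 1)⟫ ^ 2 +
    ⟪fderiv ℝ (fderiv ℝ f) z 1 1, cross7 (f z) (fderiv ℝ f z Complex.I)⟫ ^ 2 with hQ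
  -- Pairing w with f_xx and f_xy gives a linear system for ⟨w, J f_x⟩ and ⟨w, J f_y⟩ with
  -- determinant -(A² + B²) = -Q.
  have hdual : ∀ z ∈ U, Q z ≠ 0 → ⟪w, cross7 (f z) (fderiv ℝ f z 1)⟫ = 0 ∧
      ⟪w, cross7 (f z) (fderiv ℝ f z Complex.I)⟫ = 0 := by
    intro z hz hQz
    have hE := (h.pos hz).ne'
    have k1 := hP z hz 1 1
    have k2 := hP z hz 1 Complex.I
    rw [axis_snd_expand h hv hz 1 1] at k1
    rw [axis_snd_expand h hv hz 1 Complex.I, h.snd_J_one_I_one hz, h.snd_J_one_I_I hz] at k2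
    simp only [inner_add_right, real_inner_smul_right, hw z hz, hD z hz] at k1 k2
    field_simp at k1 k2
    simp only [hQ] at hQz
    set A := ⟪fderiv ℝ (fderiv ℝ f) z 1 1, cross7 (f z) (fderiv ℝ f z 1)⟫
    set B := ⟪fderiv ℝ (fderiv ℝ f) z 1 1, cross7 (f z) (fderiv ℝ f z Complex.I)⟫
    constructor
    · refine (mul_eq_zero.mp ?_).resolve_left hQz
      linear_combination A * k1 + B * k2
    · refine (mul_eq_zero.mp ?_).resolve_left hQz
      linear_combination B * k1 - A * k2
  suffices hQ0 : Q z = 0 by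
    simp only [hQ] at hQ0
    refine axis_geodesic_of_cubic_eq_zero h hv hz ?_ ?_ X Y <;> nlinarith
  by_contra hne
  have hcont : ContinuousAt Q z := by
    have c1 : ContinuousAt (fun z => fderiv ℝ (fderiv ℝ f) z 1 1) z := by
      have d1 : ContDiffAt ℝ ∞ (fderiv ℝ (fderiv ℝ f)) z :=
        ((h.smooth.contDiffAt (h.isOpen.mem_nhds hz)).fderiv_right (m := ∞) (by simp)).fderiv_right
          (m := ∞) (by simp)
      exact (d1.continuousAt.clm_apply continuousAt_const).clm_apply continuousAt_const
    have c2 := fun X => (h.hasFDerivAt_J hz X).continuousAt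
    exact ((c1.inner (c2 1)).pow 2).add ((c1.inner (c2 Complex.I)).pow 2)
  have hnear : ∀ᶠ z' in nhds z, z' ∈ U ∧ Q z' ≠ 0 :=
    (h.isOpen.eventually_mem hz).and (hcont.eventually_ne hne)
  obtain ⟨W, hW, hWo, hzW⟩ := eventually_nhds_iff.mp hnear
  have hE := (h.pos hz).ne'
  obtain ⟨d1, d2⟩ := hdual z hz hne
  -- Near z, where Q does not vanish, ⟨w, f × f_x⟩ = 0 may be differentiated in y. The term with
  -- f_xy vanishes, which leaves w orthogonal to f_x × f_y and hence to the whole frame.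
  have k := inner_fderiv_eq_zero hWo hzW (hasFDerivAt_const w z) (h.hasFDerivAt_J hz 1)
    (fun y hy => (hdual y (hW y hy).1 (hW y hy).2).1) Complex.I
  simp only [ContinuousLinearMap.flip_apply, add_apply, ContinuousLinearMap.comp_apply,
    crossL_apply, zero_apply, inner_zero_left, add_zero, inner_add_right] at k
  have k' : ⟪w, cross7 (f z) (fderiv ℝ (fderiv ℝ f) z Complex.I 1)⟫ = 0 := by
    rw [axis_snd_expand h hv hz]
    simp only [cross7_add_right, cross7_smul_right, cross7_self, cross7_cross7_self,
      h.inner_point_fderiv hz, inner_add_right, inner_sub_right, real_inner_smul_right, d1, d2,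
      hD z hz, inner_zero_right]
    ring
  have hn : ⟪w, cross7 (fderiv ℝ f z 1) (fderiv ℝ f z Complex.I)⟫ = 0 := by
    rw [cross7_anticomm, inner_neg_right]
    linarith
  refine hw0 ((h.frame hz).eq_zero (hw z hz) (hD z hz 1) (hD z hz Complex.I) d1 d2 hn ?_)
  rw [← h.smul_crossNormal hz, cross7_smul_right, real_inner_smul_right, ← crossAxis, hv z hz, hwv,
    mul_zero]

end Axis

/-- A totally real minimal surface obtained by rotating an almost complex curve in `v^⊥` about
`v`. -/
theorem crossNormalIsDual_of_rotation {f g : ℂ → E7} {U : Set ℂ} (h : IsTotallyRealMinimalOn f U)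
    {v : E7} {c s ε : ℝ} (hv : ⟪v, v⟫ = 1) (hcs : c ^ 2 + s ^ 2 = 1) (hε : ε ^ 2 = 1)
    (hg : ContDiffOn ℝ ∞ g U) (hgg : ∀ z ∈ U, ⟪g z, g z⟫ = 1) (hvg : ∀ z ∈ U, ⟪v, g z⟫ = 0)
    (hJ : ∀ z ∈ U, ∀ X, cross7 (g z) (fderiv ℝ g z X) = ε • fderiv ℝ g z (Complex.I * X))
    (hfg : ∀ z ∈ U, f z = c • g z + s • cross7 v (g z)) : CrossNormalIsDual f U := by
  have hgd : ∀ z ∈ U, HasFDerivAt g (fderiv ℝ g z) z := fun z hz =>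
    hg.hasFDerivAt_of_isOpen h.isOpen hz
  have hvD : ∀ z ∈ U, ∀ X, ⟪v, fderiv ℝ g z X⟫ = 0 := fun z hz X => by
    simpa using inner_fderiv_eq_zero h.isOpen hz (hasFDerivAt_const v z) (hgd z hz) hvg X
  have hgD : ∀ z ∈ U, ∀ X, ⟪g z, fderiv ℝ g z X⟫ = 0 := fun z hz X => by
    have h1 := inner_fderiv_eq_zero h.isOpen hz (hgd z hz) (hgd z hz) hgg X
    rw [real_inner_comm (g z)] at h1
    linarith
  have hfD : ∀ z ∈ U, ∀ X, fderiv ℝ f z X =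
      c • fderiv ℝ g z X + s • cross7 v (fderiv ℝ g z X) := by
    intro z hz X
    have k := ((hgd z hz).const_smul c).add
      ((((hasFDerivAt_const v z).cross7 (hgd z hz))).const_smul s)
    have k' := k.congr_of_eventuallyEq (Filter.eventually_of_mem (h.isOpen.mem_nhds hz) hfg)
    rw [k'.fderiv]
    simp
  have hvf : ∀ z ∈ U, ⟪v, f z⟫ = 0 := fun z hz => by
    rw [hfg z hz, inner_add_right, real_inner_smul_right, real_inner_smul_right, hvg z hz,
      real_inner_comm, inner_cross7_left]
    ring
  have hvfD : ∀ z ∈ U, ∀ X, ⟪v, fderiv ℝ f z X⟫ = 0 := fun z hz X => by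
    rw [hfD z hz, inner_add_right, real_inner_smul_right, real_inner_smul_right, hvD z hz,
      real_inner_comm, inner_cross7_left]
    ring
  -- For c = cos β and s = sin β these are K = ε cos 3β and τ = -ε sin 3β: the product doubles the
  -- angle and rewriting in terms of df adds it once more.
  set K := ε * ((c ^ 2 - s ^ 2) * c - 2 * c * s * s) with hK
  set τ := ε * (-(c ^ 2 - s ^ 2) * s - 2 * c * s * c) with hτ
  have hJf : ∀ z ∈ U, ∀ X, cross7 (f z) (fderiv ℝ f z X) = K • fderiv ℝ f z (Complex.I * X) +
      τ • cross7 v (fderiv ℝ f z (Complex.I * X)) := by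
    intro z hz X
    rw [hfg z hz, hfD z hz, cross7_rotate c s hv (hvg z hz) (hvD z hz X) (hgD z hz X)
      (by rw [hJ z hz, real_inner_smul_left, real_inner_comm, hvD z hz, mul_zero]), hJ z hz,
      hfD z hz, cross7_smul_right, cross7_add_right, cross7_smul_right, cross7_smul_right,
      cross7_cross7_self, hvD z hz, hv]
    generalize fderiv ℝ g z (Complex.I * X) = q
    have e1 : ε * (c ^ 2 - s ^ 2) = K * c - τ * s := by
      rw [hK, hτ]; linear_combination (-ε * (c ^ 2 - s ^ 2)) * hcs
    have e2 : -(ε * (2 * c * s)) = K * s + τ * c := by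
      rw [hK, hτ]; linear_combination (ε * (2 * c * s)) * hcs
    trans (ε * (c ^ 2 - s ^ 2)) • q + (-(ε * (2 * c * s))) • cross7 v q
    · module
    · rw [e1, e2]; module
  have hKτ : K ^ 2 + τ ^ 2 = 1 := by
    have : K ^ 2 + τ ^ 2 = ε ^ 2 * (c ^ 2 + s ^ 2) ^ 3 := by rw [hK, hτ]; ring
    rw [this, hε, hcs]; norm_num
  intro z hz
  have hE := (h.pos hz).ne'
  -- K is the component of J f_x along f_y, which total reality excludes.
  have hK0 : K = 0 := by
    have h1 := h.real z hz 1 Complex.I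
    rw [hJf z hz, mul_one, inner_add_left, real_inner_smul_left, real_inner_smul_left,
      inner_cross7_right, (h.frame hz).bb] at h1
    simpa [hE] using h1
  have hτ2 : τ ^ 2 = 1 := by rw [hK0] at hKτ; linarith
  have hJf' : ∀ z ∈ U, ∀ X, cross7 (f z) (fderiv ℝ f z X) =
      τ • cross7 v (fderiv ℝ f z (Complex.I * X)) := fun z hz X => by
    rw [hJf z hz, hK0, zero_smul, zero_add]
  -- From J a = τ v × b one gets a × (v × f) = -τ b; a second product with a recovers a × b = τ E v
  -- × f.
  have hN : ∀ z ∈ U, crossNormal f z = τ • cross7 v (f z) := by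
    intro z hz
    have hf := h.frame hz
    have hE := (h.pos hz).ne'
    set a := fderiv ℝ f z 1 with ha
    set b := fderiv ℝ f z Complex.I with hb
    have e0 := hJf' z hz 1
    rw [mul_one, ← ha, ← hb] at e0
    have e1 : cross7 a (cross7 v (f z)) = -(τ • b) := by
      have k := cross7_cross7_symm v a (f z)
      rw [hvf z hz, real_inner_comm, hf.pa, hvfD z hz, cross7_anticomm a (f z), e0,
        cross7_neg_right, cross7_smul_right, cross7_cross7_self, hvfD z hz, hv] at k
      rw [eq_sub_of_add_eq' k]
      module
    have e2 : ⟪a, cross7 v (f z)⟫ = 0 := by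
      rw [real_inner_comm, inner_cross7_cyclic, e0, real_inner_smul_left, inner_cross7_left,
        mul_zero]
    have e3 := cross7_cross7_self a (cross7 v (f z))
    rw [e1, e2, hf.aa, cross7_neg_right, cross7_smul_right] at e3
    rw [crossNormal, inv_smul_eq_iff₀ hE, ← ha, ← hb]
    have e4 := congrArg (fun w => -τ • w) e3
    simp only [smul_neg, smul_smul, zero_smul, zero_sub] at e4
    rw [neg_mul, ← pow_two, hτ2, neg_smul, one_smul, neg_neg] at e4
    rw [e4]
    module
  intro X
  have k := (((hasFDerivAt_const v z).cross7 (h.hasFDerivAt hz)).const_smul τ)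
  have k' := k.congr_of_eventuallyEq (Filter.eventually_of_mem (h.isOpen.mem_nhds hz) hN)
  rw [k'.fderiv, hJf' z hz, ← mul_assoc, Complex.I_mul_I, neg_one_mul, map_neg, cross7_neg_right]
  simp

/-! ### Riemann surfaces -/

section Charts

variable {S : Type*} [TopologicalSpace S] [ChartedSpace ℂ S] [IsManifold 𝓘(ℂ) ω S]

theorem contDiffOn_transition {e e' : OpenPartialHomeomorph S ℂ} (he : e ∈ atlas ℂ S)
    (he' : e' ∈ atlas ℂ S) : ContDiffOn ℂ ω (e.symm ≫ₕ e') (e.symm ≫ₕ e').source := by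
  have h := (contDiffGroupoid ω 𝓘(ℂ)).compatible he he'
  rw [contDiffGroupoid, mem_groupoid_of_pregroupoid] at h
  simpa [contDiffPregroupoid] using h.1

/-- A Riemann surface is a smooth real surface. -/
theorem isManifold_real_of_complex : IsManifold 𝓘(ℝ, ℂ) ∞ S := by
  refine isManifold_of_contDiffOn _ _ _ fun e e' he he' => ?_
  have h := ((contDiffOn_transition he he').restrict_scalars ℝ).of_le (m := ∞) le_top
  simpa using h

theorem ContMDiff.contDiffOn_comp_symm {f : S → E7} (hf : ContMDiff 𝓘(ℝ, ℂ) 𝓘(ℝ, E7) ∞ f)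
    {e : OpenPartialHomeomorph S ℂ} (he : e ∈ atlas ℂ S) :
    ContDiffOn ℝ ∞ (f ∘ e.symm) e.target := by
  have := isManifold_real_of_complex (S := S)
  rw [← contMDiffOn_iff_contDiffOn]
  exact hf.comp_contMDiffOn
    (contMDiffOn_symm_of_mem_maximalAtlas (IsManifold.subset_maximalAtlas he))

end Charts

/-- Under a complex-linear change by c both f_x × f_y and the conformal factor are multiplied by
|c|², so N does not change. -/
theorem crossAxis_congr_chart {f g : ℂ → E7} {z w c : ℂ} (hc : c ≠ 0) (hfg : f z = g w)
    (hgc : firstFF g w 1 1 = firstFF g w Complex.I Complex.I) (hgo : firstFF g w 1 Complex.I = 0)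
    (hD : ∀ X, fderiv ℝ f z X = fderiv ℝ g w (c * X)) : crossAxis f z = crossAxis g w := by
  have h1 : fderiv ℝ f z 1 = c.re • fderiv ℝ g w 1 + c.im • fderiv ℝ g w Complex.I := by
    rw [hD, mul_one, clm_complex_apply]
  have h2 : fderiv ℝ f z Complex.I = -c.im • fderiv ℝ g w 1 + c.re • fderiv ℝ g w Complex.I := by
    rw [hD, mul_comm, clm_complex_apply_I_mul]
  have hn : c.re ^ 2 + c.im ^ 2 ≠ 0 := by
    have := Complex.normSq_pos.mpr hc
    rw [Complex.normSq_apply] at this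
    nlinarith
  simp only [firstFF] at hgc hgo
  have hE : firstFF f z 1 1 = (c.re ^ 2 + c.im ^ 2) * firstFF g w 1 1 := by
    have hgo' := hgo
    rw [real_inner_comm] at hgo'
    simp only [firstFF, h1]
    simp only [inner_add_left, inner_add_right, real_inner_smul_left, real_inner_smul_right, hgo,
      hgo', ← hgc]
    ring
  have hX : cross7 (fderiv ℝ f z 1) (fderiv ℝ f z Complex.I) =
      (c.re ^ 2 + c.im ^ 2) • cross7 (fderiv ℝ g w 1) (fderiv ℝ g w Complex.I) := by
    rw [h1, h2]
    simp only [cross7_add_left, cross7_add_right, cross7_smul_left, cross7_smul_right, cross7_self,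
      cross7_anticomm (fderiv ℝ g w Complex.I)]
    module
  rw [crossAxis, crossAxis, crossNormal, crossNormal, hfg, hE, hX, smul_smul, mul_inv_rev,
    mul_assoc, inv_mul_cancel₀ hn, mul_one]

/-- A family of vectors in `v^⊥` that does not span it has a common normal in `v^⊥`. -/
theorem exists_orthogonal_of_finrank_ne {S : Type*} {v : E7} {ψ : S → E7} (hv : ‖v‖ = 1)
    (hψ : ∀ p, ⟪v, ψ p⟫ = 0) (hr : Module.finrank ℝ (Submodule.span ℝ (Set.range ψ)) ≠ 6) :
    ∃ w : E7, w ≠ 0 ∧ ⟪w, v⟫ = 0 ∧ ∀ p, ⟪w, ψ p⟫ = 0 := by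
  have hv0 : v ≠ 0 := fun h => by simp [h] at hv
  set W := Submodule.span ℝ (Set.range ψ)
  have : Fact (Module.finrank ℝ E7 = 6 + 1) := ⟨by simp⟩
  have hle : W ≤ (ℝ ∙ v)ᗮ := by
    rw [Submodule.span_le]
    rintro _ ⟨p, rfl⟩
    exact Submodule.mem_orthogonal_singleton_iff_inner_right.mpr (hψ p)
  have h6 : Module.finrank ℝ W < 6 :=
    lt_of_le_of_ne ((Submodule.finrank_mono hle).trans_eq
      (Submodule.finrank_orthogonal_span_singleton hv0)) hr
  have hne : W ⊔ (ℝ ∙ v) ≠ ⊤ := by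
    intro htop
    have h1 := Submodule.finrank_add_le_finrank_add_finrank W (ℝ ∙ v)
    rw [htop, finrank_top, finrank_span_singleton hv0] at h1
    have h2 : Module.finrank ℝ E7 = 7 := by simp
    omega
  have hbot : (W ⊔ (ℝ ∙ v))ᗮ ≠ ⊥ := fun h => hne (Submodule.orthogonal_eq_bot_iff.mp h)
  obtain ⟨w, hw, hw0⟩ := Submodule.exists_mem_ne_zero_of_ne_bot hbot
  rw [Submodule.mem_orthogonal'] at hw
  exact ⟨w, hw0, hw _ (Submodule.mem_sup_right (Submodule.mem_span_singleton_self v)),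
    fun p => hw _ (Submodule.mem_sup_left (Submodule.subset_span ⟨p, rfl⟩))⟩

/-! ### Passing from charts to the surface. -/

section Surface

variable {S : Type*} [TopologicalSpace S] [ChartedSpace ℂ S] [IsManifold 𝓘(ℂ) ω S]

theorem IsConformalImmersion.on_chart {f : S → E7} (hf : IsConformalImmersion f)
    {e : OpenPartialHomeomorph S ℂ} (he : e ∈ atlas ℂ S) :
    IsConformalImmersionOn (f ∘ e.symm) e.target where
  isOpen := e.open_target
  smooth := hf.1.contDiffOn_comp_symm he
  inj := fun z hz => (hf.2 e he z hz).1
  conf := fun z hz => (hf.2 e he z hz).2.1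
  orth := fun z hz => (hf.2 e he z hz).2.2

/-- Minimality in the sphere makes the Laplacian a multiple of φ; differentiating |φ|² = 1 twice
fixes the multiple as -2E. -/
theorem isTotallyRealMinimalOn_chart {φ : S → E7} (hmin : IsMinimalImmersionInSphere φ)
    (hreal : IsTotallyReal φ) {e : OpenPartialHomeomorph S ℂ} (he : e ∈ atlas ℂ S) :
    IsTotallyRealMinimalOn (φ ∘ e.symm) e.target := by
  have hc := hmin.2.1.on_chart he
  have hnorm : ∀ z, ⟪(φ ∘ e.symm) z, (φ ∘ e.symm) z⟫ = 1 := fun z => by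
    rw [real_inner_self_eq_norm_sq, Function.comp_apply, hmin.1, one_pow]
  refine ⟨hc, fun z _ => hnorm z, hreal e he, fun z hz => ?_⟩
  have hE := (hc.pos hz).ne'
  have hp : ∀ w ∈ e.target, ∀ X, ⟪(φ ∘ e.symm) w, fderiv ℝ (φ ∘ e.symm) w X⟫ = 0 := by
    intro w hw X
    have h1 := inner_fderiv_eq_zero e.open_target hw (hc.hasFDerivAt hw) (hc.hasFDerivAt hw)
      (fun w _ => hnorm w) X
    rw [real_inner_comm ((φ ∘ e.symm) w)] at h1
    linarith
  have hs : ∀ X, ⟪(φ ∘ e.symm) z, fderiv ℝ (fderiv ℝ (φ ∘ e.symm)) z X X⟫ =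
      -firstFF (φ ∘ e.symm) z X X := by
    intro X
    have h1 := inner_fderiv_eq_zero e.open_target hz (hc.hasFDerivAt hz)
      (hc.hasFDerivAt_fderiv hz X)
      (fun w hw => hp w hw X) X
    simp only [ContinuousLinearMap.flip_apply] at h1
    rw [firstFF]
    linarith
  have h1 := hmin.2.2 e he z hz
  rw [sub_eq_zero, hc.meanCurvature_eq hz, real_inner_smul_left, mul_smul] at h1
  have h2 := smul_right_injective E7 (inv_ne_zero (mul_ne_zero two_ne_zero hE)) h1
  rw [h2, inner_add_left, real_inner_comm (φ (e.symm z)), real_inner_comm (φ (e.symm z))]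
  have h3 := hs 1
  have h4 := hs Complex.I
  rw [← hc.conf z hz] at h4
  simp only [Function.comp_apply] at h3 h4 ⊢
  rw [h3, h4]
  congr 1
  ring

variable {φ F : S → E7}

theorem crossAxis_chart_eq (hmin : IsMinimalImmersionInSphere φ)
    {e e' : OpenPartialHomeomorph S ℂ} (he : e ∈ atlas ℂ S) (he' : e' ∈ atlas ℂ S) {p : S}
    (hp : p ∈ e.source) (hp' : p ∈ e'.source) :
    crossAxis (φ ∘ e.symm) (e p) = crossAxis (φ ∘ e'.symm) (e' p) := by
  have hc := hmin.2.1.on_chart he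
  have hc' := hmin.2.1.on_chart he'
  have hz := e.map_source hp
  have hz' := e'.map_source hp'
  have hmem : e p ∈ (e.symm ≫ₕ e').source := by
    simp [hz, e.left_inv hp, hp']
  have hT : (e.symm ≫ₕ e') (e p) = e' p := by simp [e.left_inv hp]
  have hd := ((((contDiffOn_transition he he').contDiffAt
    ((e.symm ≫ₕ e').open_source.mem_nhds hmem)).differentiableAt (by simp)).hasDerivAt)
  set c := deriv (e.symm ≫ₕ e') (e p) with hcdef
  have hg : HasFDerivAt (φ ∘ e'.symm) (fderiv ℝ (φ ∘ e'.symm) (e' p)) ((e.symm ≫ₕ e') (e p)) := by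
    rw [hT]
    exact hc'.hasFDerivAt hz'
  have hcomp := hg.comp (e p) (hd.hasFDerivAt.restrictScalars ℝ)
  have heq : (φ ∘ e.symm) =ᶠ[nhds (e p)] (φ ∘ e'.symm) ∘ (e.symm ≫ₕ e') := by
    refine Filter.eventually_of_mem ((e.symm ≫ₕ e').open_source.mem_nhds hmem) fun w hw => ?_
    simp only [OpenPartialHomeomorph.trans_source, OpenPartialHomeomorph.symm_source,
      Set.mem_inter_iff, Set.mem_preimage] at hw
    simp [e'.left_inv hw.2]
  have hD : ∀ X, fderiv ℝ (φ ∘ e.symm) (e p) X = fderiv ℝ (φ ∘ e'.symm) (e' p) (c * X) := by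
    intro X
    rw [(hcomp.congr_of_eventuallyEq heq).fderiv]
    simp [mul_comm]
  refine crossAxis_congr_chart ?_ ?_ (hc'.conf _ hz') (hc'.orth _ hz') hD
  · intro h0
    have h1 := hD 1
    rw [h0, zero_mul, map_zero] at h1
    have h2 := hc.pos hz
    rw [firstFF, h1, inner_zero_left] at h2
    exact lt_irrefl _ h2
  · simp [e.left_inv hp, e'.left_inv hp']

/-- If `crossNormal` is dual in all charts, then the vectors `J N` are one constant vector. -/
theorem exists_const_crossAxis [ConnectedSpace S] (hmin : IsMinimalImmersionInSphere φ)
    (hreal : IsTotallyReal φ)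
    (hD : ∀ e ∈ atlas ℂ S, CrossNormalIsDual (φ ∘ e.symm) e.target) :
    ∃ v, ∀ e ∈ atlas ℂ S, ∀ z ∈ e.target, crossAxis (φ ∘ e.symm) z = v := by
  let V : S → E7 := fun p => crossAxis (φ ∘ (chartAt ℂ p).symm) (chartAt ℂ p p)
  have hV : ∀ e ∈ atlas ℂ S, ∀ p ∈ e.source, V p = crossAxis (φ ∘ e.symm) (e p) := fun e he p hp =>
    crossAxis_chart_eq hmin (chart_mem_atlas ℂ p) he (mem_chart_source ℂ p) hp
  have hloc : IsLocallyConstant V := by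
    rw [IsLocallyConstant.iff_eventually_eq]
    intro p
    set e := chartAt ℂ p
    have he : e ∈ atlas ℂ S := chart_mem_atlas ℂ p
    have hp : p ∈ e.source := mem_chart_source ℂ p
    have h := isTotallyRealMinimalOn_chart hmin hreal he
    obtain ⟨r, hr, hball⟩ := Metric.isOpen_iff.mp e.open_target (e p) (e.map_source hp)
    have hconst : ∀ z ∈ Metric.ball (e p) r,
        crossAxis (φ ∘ e.symm) z = crossAxis (φ ∘ e.symm) (e p) := fun z hz =>
      Metric.isOpen_ball.is_const_of_fderiv_eq_zero (𝕜 := ℝ)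
        (convex_ball (e p) r).isPreconnected
        (fun w hw => (h.differentiableAt_crossAxis (hball hw)).differentiableWithinAt)
        (fun w hw => h.fderiv_crossAxis (hball hw) (hD e he)) hz (Metric.mem_ball_self hr)
    filter_upwards [e.open_source.mem_nhds hp,
      (e.continuousAt hp).preimage_mem_nhds (Metric.ball_mem_nhds (e p) hr)] with q hq hq'
    rw [hV e he q hq, hV e he p hp]
    exact hconst _ hq'
  obtain ⟨p₀⟩ := (inferInstance : Nonempty S)
  refine ⟨V p₀, fun e he z hz => ?_⟩
  have h1 := hV e he (e.symm z) (e.map_target hz)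
  rw [e.right_inv hz] at h1
  rw [← h1]
  exact hloc.apply_eq_of_preconnectedSpace _ _

theorem isConformalImmersion_associated (hmin : IsMinimalImmersionInSphere φ)
    (hreal : IsTotallyReal φ) (hF : IsAssociatedSurface φ F) {s : ℝ} (hs : s ^ 2 = 1) :
    IsConformalImmersion (fun p => F p + s • φ p) := by
  refine ⟨hF.1.add
    ((s • ContinuousLinearMap.id ℝ E7).contDiff.contMDiff.comp hmin.2.1.1), fun e he z hz => ?_⟩
  have h := associated_isConformalImmersionOn (isTotallyRealMinimalOn_chart hmin hreal he)
    (hF.1.contDiffOn_comp_symm he) (hF.2 e he) hs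
  exact ⟨h.inj z hz, h.conf z hz, h.orth z hz⟩

theorem parallel_associated_iff (hmin : IsMinimalImmersionInSphere φ)
    (hreal : IsTotallyReal φ) (hF : IsAssociatedSurface φ F) :
    (∀ s : ℝ, s ^ 2 = 1 → HasParallelMeanCurvature (fun p => F p + s • φ p)) ↔
      ∀ e ∈ atlas ℂ S, CrossNormalIsDual (φ ∘ e.symm) e.target := by
  have key : ∀ e ∈ atlas ℂ S, _ := fun e he =>
    associated_parallel_iff (isTotallyRealMinimalOn_chart hmin hreal he)
      (hF.1.contDiffOn_comp_symm he) (hF.2 e he)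
  constructor
  · exact fun h e he => (key e he).mp fun s hs z hz X => h s hs e he z hz X
  · exact fun h s hs e he z hz X => (key e he).mpr (h e he) s hs z hz X

/-- Rotating by a right angle about the common axis `v` yields an almost complex curve. -/
theorem isAlmostComplexCurve_of_axis [ConnectedSpace S] (hmin : IsMinimalImmersionInSphere φ)
    (hreal : IsTotallyReal φ) {v : E7}
    (hv : ∀ e ∈ atlas ℂ S, ∀ z ∈ e.target, crossAxis (φ ∘ e.symm) z = v)
    (hvv : ⟪v, v⟫ = 1) (hvφ : ∀ p, ⟪v, φ p⟫ = 0) :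
    IsAlmostComplexCurve 1 (fun p => -cross7 v (φ p)) := by
  have hinv : ∀ p, φ p = cross7 v (-cross7 v (φ p)) := fun p => by
    rw [cross7_neg_right, cross7_cross7_self, hvφ, hvv]
    module
  refine ⟨fun p => ?_, ?_, ?_, fun e he z hz X => ?_⟩
  · have h1 : ⟪φ p, φ p⟫ = 1 := by rw [real_inner_self_eq_norm_sq, hmin.1, one_pow]
    rw [norm_neg, ← sq_eq_sq₀ (norm_nonneg _) zero_le_one, ← real_inner_self_eq_norm_sq,
      inner_cross7_cross7, hvφ, hvv, h1]
    norm_num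
  · by_contra! hcon
    obtain ⟨p₀⟩ := (inferInstance : Nonempty S)
    have hconst : ∀ p, φ p = φ p₀ := fun p => by rw [hinv p, hcon p p₀, ← hinv]
    have he := chart_mem_atlas ℂ p₀
    have hz := mem_chart_target ℂ p₀
    have h1 := ((hmin.2.1.on_chart he).pos hz)
    have h2 : φ ∘ (chartAt ℂ p₀).symm = fun _ => φ p₀ := funext fun z => hconst _
    rw [firstFF, h2, fderiv_fun_const] at h1
    simp at h1
  · exact ((-(crossL v)).contDiff.contMDiff).comp hmin.2.1.1
  · have h := isTotallyRealMinimalOn_chart hmin hreal he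
    have hD : ∀ Y, fderiv ℝ ((fun p => -cross7 v (φ p)) ∘ e.symm) z Y =
        -cross7 v (fderiv ℝ (φ ∘ e.symm) z Y) := by
      intro Y
      have k : HasFDerivAt ((fun p => -cross7 v (φ p)) ∘ e.symm)
          ((-(crossL v)).comp (fderiv ℝ (φ ∘ e.symm) z)) z :=
        (-(crossL v)).hasFDerivAt.comp z (h.hasFDerivAt hz)
      rw [k.fderiv]
      simp
    have hvD := h.inner_crossAxis_fderiv hz
    have hJ := h.cross7_crossAxis_fderiv hz
    have hz' := hv e he z hz
    rw [hz'] at hvD hJ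
    have hJ' : cross7 (φ (e.symm z)) (fderiv ℝ (φ ∘ e.symm) z X) =
        cross7 v (fderiv ℝ (φ ∘ e.symm) z (Complex.I * X)) := by
      rw [hJ, ← mul_assoc, Complex.I_mul_I, neg_one_mul, map_neg, cross7_neg_right, neg_neg]
      rfl
    -- The quarter turn: (v × φ) × (v × φ_X) = -φ × φ_X.
    have hrot := cross7_rotate 0 1 hvv (hvφ (e.symm z)) (hvD X) (h.inner_point_fderiv hz X) (by
      have : ⟪cross7 ((φ ∘ e.symm) z) (fderiv ℝ (φ ∘ e.symm) z X), v⟫ = 0 := by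
        rw [Function.comp_apply, hJ', inner_cross7_left]
      exact this)
    simp only [zero_smul, zero_add, one_smul] at hrot
    rw [one_smul, hD, hD, cross7_neg_left, cross7_neg_right, neg_neg]
    refine Eq.trans ?_ hrot.symm
    rw [hJ']
    module

end Surface

end

/-! ### The equivalence. -/

theorem mainTheorem5 {S : Type*} [TopologicalSpace S] [T2Space S] [ConnectedSpace S]
    [ChartedSpace ℂ S] [IsManifold 𝓘(ℂ) ω S]
    (φ F : S → E7)
    (hmin : IsMinimalImmersionInSphere φ)
    (hreal : IsTotallyReal φ)
    (hF : IsAssociatedSurface φ F) :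
    (IsConformalImmersion (fun p => F p + φ p) ∧ IsConformalImmersion (fun p => F p - φ p)) ∧
    ((HasParallelMeanCurvature (fun p => F p + φ p) ∧
        HasParallelMeanCurvature (fun p => F p - φ p)) ↔
      ((∃ (ε : ℤˣ) (v : E7) (β : ℝ) (ψ : S → E7),
          ‖v‖ = 1 ∧ IsAlmostComplexCurveTypeIII ε ψ ∧ (∀ p, ⟪v, ψ p⟫ = 0) ∧
            ∀ p, φ p = rotation7 v β (ψ p)) ∨
        IsTotallyGeodesicInSphere φ)) := by
  have hplus : (fun p => F p + φ p) = fun p => F p + (1 : ℝ) • φ p := by simp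
  have hminus : (fun p => F p - φ p) = fun p => F p + (-1 : ℝ) • φ p := by simp [sub_eq_add_neg]
  rw [hplus, hminus]
  refine ⟨⟨isConformalImmersion_associated hmin hreal hF (by norm_num),
    isConformalImmersion_associated hmin hreal hF (by norm_num)⟩, ?_⟩
  have hiff : (HasParallelMeanCurvature (fun p => F p + (1 : ℝ) • φ p) ∧
      HasParallelMeanCurvature (fun p => F p + (-1 : ℝ) • φ p)) ↔
      ∀ e ∈ atlas ℂ S, CrossNormalIsDual (φ ∘ e.symm) e.target := by
    rw [← parallel_associated_iff hmin hreal hF]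
    refine ⟨fun h s hs => ?_, fun h => ⟨h 1 (by norm_num), h (-1) (by norm_num)⟩⟩
    rcases sq_eq_sq_iff_eq_or_eq_neg.mp (hs.trans (one_pow 2).symm) with rfl | rfl
    · exact h.1
    · exact h.2
  rw [hiff]
  constructor
  · intro hD
    obtain ⟨v, hv⟩ := exists_const_crossAxis hmin hreal hD
    have hcharts : ∀ p : S, ∃ e ∈ atlas ℂ S, ∃ z ∈ e.target, e.symm z = p := fun p =>
      ⟨_, chart_mem_atlas ℂ p, _, mem_chart_target ℂ p,
        (chartAt ℂ p).left_inv (mem_chart_source ℂ p)⟩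
    have hvv : ⟪v, v⟫ = 1 := by
      obtain ⟨p₀⟩ := (inferInstance : Nonempty S)
      obtain ⟨e, he, z, hz, -⟩ := hcharts p₀
      rw [← hv e he z hz]
      exact (isTotallyRealMinimalOn_chart hmin hreal he).inner_crossAxis_self hz
    have hvn : ‖v‖ = 1 := by
      rw [← sq_eq_sq₀ (norm_nonneg _) zero_le_one, ← real_inner_self_eq_norm_sq, hvv, one_pow]
    have hvφ : ∀ p, ⟪v, φ p⟫ = 0 := by
      intro p
      obtain ⟨e, he, z, hz, rfl⟩ := hcharts p
      rw [← hv e he z hz]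
      exact IsTotallyRealMinimalOn.inner_crossAxis_point
    have hvψ : ∀ p, ⟪v, -cross7 v (φ p)⟫ = 0 := fun p => by
      rw [inner_neg_right, real_inner_comm, inner_cross7_left, neg_zero]
    by_cases hr : Module.finrank ℝ (Submodule.span ℝ (Set.range fun p => -cross7 v (φ p))) = 6
    -- A quarter turn undoes the definition of ψ, since v × (-v × φ) = φ for φ orthogonal to the
    -- unit vector v.
    · refine Or.inl ⟨1, v, Real.pi / 2, fun p => -cross7 v (φ p), hvn,
        ⟨isAlmostComplexCurve_of_axis hmin hreal hv hvv hvφ, hr⟩, hvψ, fun p => ?_⟩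
      rw [rotation7, hvψ, Real.cos_pi_div_two, Real.sin_pi_div_two, cross7_neg_right,
        cross7_cross7_self, hvφ, hvv]
      module
    · right
      obtain ⟨w, hw0, hwv, hw⟩ := exists_orthogonal_of_finrank_ne hvn hvψ hr
      intro e he z hz X Y
      -- By skew-symmetry w ⊥ v × φ means v × w ⊥ φ; moreover v × w is nonzero because w ≠ 0 is
      -- orthogonal to v.
      refine axis_geodesic_of_degenerate (isTotallyRealMinimalOn_chart hmin hreal he) (hv e he)
        (w := cross7 v w) ?_ (inner_cross7_left v w) (fun z _ => ?_) hz X Y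
      · intro h0
        have h1 := cross7_cross7_self v w
        rw [h0, cross7_zero_right, real_inner_comm, hwv, hvv, zero_smul, one_smul, zero_sub] at h1
        exact hw0 (neg_eq_zero.mp h1.symm)
      · have h1 := hw (e.symm z)
        rw [inner_neg_right] at h1
        rw [inner_cross7_skew]
        exact h1
  · rintro (⟨ε, v, β, ψ, hv, ⟨⟨hψ1, -, hψs, hψJ⟩, -⟩, hvψ, hφ⟩ | hgeo) e he
    · have hvv : ⟪v, v⟫ = 1 := by rw [real_inner_self_eq_norm_sq, hv, one_pow]
      refine crossNormalIsDual_of_rotation (g := ψ ∘ e.symm) (c := Real.cos β) (s := Real.sin β)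
        (ε := ((ε : ℤ) : ℝ)) (isTotallyRealMinimalOn_chart hmin hreal he) hvv
        (Real.cos_sq_add_sin_sq β) ?_ (hψs.contDiffOn_comp_symm he) (fun z _ => ?_)
        (fun z _ => hvψ _) (fun z hz X => ?_) (fun z _ => ?_)
      · rcases Int.units_eq_one_or ε with rfl | rfl <;> norm_num
      · rw [real_inner_self_eq_norm_sq, Function.comp_apply, hψ1, one_pow]
      · refine (hψJ e he z hz X).symm.trans ?_
        rcases Int.units_eq_one_or ε with rfl | rfl <;> simp
      · rw [Function.comp_apply, hφ, rotation7, hvψ]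
        simp
    · exact fun z hz X =>
        (isTotallyRealMinimalOn_chart hmin hreal he).fderiv_crossNormal_of_geodesic hz (hgeo e he z hz) X
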